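/- For a diagram $D$ of a knot $K$ write $c(D)$ for its number of crossings and, after orienting $K$, $s(D)$ for its number of Seifert circles, and let $g(D)=\tfrac12\,(c(D)-s(D)+1)$ be the genus of the surface that Seifert's algorithm builds from $D$. The crossing number of $K$ is $c(K)=\min_D c(D)$ and its canonical genus is $\tilde g(K)=\min_D g(D)$, both minima being over all diagrams $D$ of $K$. A Whitehead double of $K$ is a knot that has a diagram obtained from a diagram of $K$ by replacing the curve by two parallel strands (four crossings in place of every crossing) and inserting into the two strands, at some place, a clasp of either sign and $n$ full twists, where $n$ is any integer; the different $n$ give the untwisted double and all the twisted ones. **Proposition.** For every nontrivial knot $K$ and every (twisted or untwisted, positive or negative) Whitehead double $W_K$ of $K$, $$c(K)\ \ge\ \tilde g(W_K).$$ -/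

import Mathlib

/-!
Knots are treated diagrammatically.  A link diagram in the plane is put in general position with
respect to the height function and cut into horizontal slices, each of which contains exactly one
local minimum, one local maximum or one crossing.  Links are such diagrams up to planar isotopy and
Reidemeister moves.
-/

namespace KnotTheory

/-- The non-trivial part of a slice: a local minimum `∪` (`cup`), a local maximum `∩` (`cap`), or a
crossing.  In `crossing true` the strand running from the lower left to the upper right passes over
the other strand, in `crossing false` it passes under it. -/
inductive Piece
  | cup
  | cap
  | crossing (b : Bool)

/-- Number of strands entering the piece from below. -/
def Piece.ins : Piece → ℕ
  | .cup => 0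
  | _ => 2

/-- Number of strands leaving the piece at the top. -/
def Piece.outs : Piece → ℕ
  | .cap => 0
  | _ => 2

/-- A slice: a piece with `pos` vertical strands to its left, and any number to its right. -/
structure Slice where
  piece : Piece
  pos : ℕ

abbrev cup (i : ℕ) : Slice := ⟨.cup, i⟩
abbrev cap (i : ℕ) : Slice := ⟨.cap, i⟩
abbrev cross (b : Bool) (i : ℕ) : Slice := ⟨.crossing b, i⟩

def Slice.isCrossing : Slice → Bool
  | ⟨.crossing _, _⟩ => true
  | _ => false

/-- Number of strands above the slice, if there are `n` strands below it. -/
def Slice.out (s : Slice) (n : ℕ) : ℕ := n - s.piece.ins + s.piece.outs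

/-- The slices of `w`, stacked from bottom to top, fit together to a tangle diagram with `n` ends
at the bottom and `m` ends at the top. -/
def Fits : ℕ → List Slice → ℕ → Prop
  | n, [], m => n = m
  | n, s :: w, m => s.pos + s.piece.ins ≤ n ∧ Fits (s.out n) w m

/-- A link diagram. -/
structure LinkDiagram where
  word : List Slice
  closed : Fits 0 word 0

/-- Number of strands at height `k`, that is, between the `k`-th slice and the next one. -/
def width (w : List Slice) (k : ℕ) : ℕ := (w.take k).foldl (fun n s => s.out n) 0

/-- The points `(k, j)` where the diagram meets the horizontal lines between the slices: `k` is
the height and `j` the position from the left. -/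
def LinkDiagram.Point (D : LinkDiagram) : Type := {p : ℕ × ℕ // p.2 < width D.word p.1}

/-- The two points are joined by one of the vertical strands of a slice. -/
inductive Passes (w : List Slice) : ℕ × ℕ → ℕ × ℕ → Prop
  | left {k j : ℕ} {s : Slice} : w[k]? = some s → j < s.pos → Passes w (k, j) (k + 1, j)
  | right {k j : ℕ} {s : Slice} : w[k]? = some s →
      Passes w (k, s.pos + s.piece.ins + j) (k + 1, s.pos + s.piece.outs + j)

/-- The two points are joined by a local minimum or a local maximum. -/
inductive Turns (w : List Slice) : ℕ × ℕ → ℕ × ℕ → Prop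
  | cup {k i : ℕ} : w[k]? = some (cup i) → Turns w (k + 1, i) (k + 1, i + 1)
  | cap {k i : ℕ} : w[k]? = some (cap i) → Turns w (k, i) (k, i + 1)

/-- The two points are joined by one of the two strands of a crossing. -/
inductive Crosses (w : List Slice) : ℕ × ℕ → ℕ × ℕ → Prop
  | right {k i : ℕ} {b : Bool} : w[k]? = some (cross b i) → Crosses w (k, i) (k + 1, i + 1)
  | left {k i : ℕ} {b : Bool} : w[k]? = some (cross b i) → Crosses w (k, i + 1) (k + 1, i)

/-- The two points are joined by one of the two arcs that replace a crossing when it is cut open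
respecting the orientation `up` (`true` for upward strands).  If both strands run upwards or both
downwards, the two arcs are vertical; otherwise one joins the two lower corners and the other the
two upper corners. -/
inductive Smooths (w : List Slice) (up : ℕ × ℕ → Bool) : ℕ × ℕ → ℕ × ℕ → Prop
  | verticalLeft {k i : ℕ} {b : Bool} : w[k]? = some (cross b i) →
      up (k, i) = up (k, i + 1) → Smooths w up (k, i) (k + 1, i)
  | verticalRight {k i : ℕ} {b : Bool} : w[k]? = some (cross b i) →
      up (k, i) = up (k, i + 1) → Smooths w up (k, i + 1) (k + 1, i + 1)
  | lower {k i : ℕ} {b : Bool} : w[k]? = some (cross b i) →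
      up (k, i) ≠ up (k, i + 1) → Smooths w up (k, i) (k, i + 1)
  | upper {k i : ℕ} {b : Bool} : w[k]? = some (cross b i) →
      up (k, i) ≠ up (k, i + 1) → Smooths w up (k + 1, i) (k + 1, i + 1)

namespace LinkDiagram

/-- Number of crossings. -/
def crossings (D : LinkDiagram) : ℕ := D.word.countP Slice.isCrossing

/-- Number of components of the link. -/
noncomputable def components (D : LinkDiagram) : ℕ :=
  Nat.card (Quot fun p q : D.Point =>
    Passes D.word p.1 q.1 ∨ Turns D.word p.1 q.1 ∨ Crosses D.word p.1 q.1)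

/-- An orientation of the diagram: `up` says at which points the link runs upwards.  (The values
of `up` off the points of the diagram are irrelevant.) -/
structure Orientation (D : LinkDiagram) where
  up : ℕ × ℕ → Bool
  passes : ∀ p q : D.Point, Passes D.word p.1 q.1 → up p.1 = up q.1
  crosses : ∀ p q : D.Point, Crosses D.word p.1 q.1 → up p.1 = up q.1
  turns : ∀ p q : D.Point, Turns D.word p.1 q.1 → up p.1 ≠ up q.1

/-- Number of Seifert circles. -/
noncomputable def seifertCircles (D : LinkDiagram) (o : D.Orientation) : ℕ :=
  Nat.card (Quot fun p q : D.Point =>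
    Passes D.word p.1 q.1 ∨ Turns D.word p.1 q.1 ∨ Smooths D.word o.up p.1 q.1)

/-- The genus `(c(D) - s(D) - |D| + 2) / 2` of the surface that Seifert's algorithm produces from
the oriented diagram.  (For a diagram of a knot, `c(D) + 2 - s(D) - |D|` is non-negative and even,
so that neither the subtraction nor the division rounds.) -/
noncomputable def genus (D : LinkDiagram) (o : D.Orientation) : ℕ :=
  (D.crossings + 2 - (D.seifertCircles o + D.components)) / 2

end LinkDiagram

/-- Planar isotopies and Reidemeister moves of sliced diagrams. -/
inductive LocalMove : List Slice → List Slice → Prop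
  /-- exchange of the heights of two pieces that lie beside each other -/
  | exchange (a b : Piece) (i d : ℕ) :
      LocalMove [⟨a, i⟩, ⟨b, i + a.outs + d⟩] [⟨b, i + a.ins + d⟩, ⟨a, i⟩]
  /-- straightening of a strand -/
  | zigzag (i : ℕ) : LocalMove [cup i, cap (i + 1)] []
  | zagzig (i : ℕ) : LocalMove [cup (i + 1), cap i] []
  /-- a strand moves from one side of a local minimum or maximum to the other, above or below it -/
  | slideCup (b : Bool) (i : ℕ) : LocalMove [cup i, cross b (i + 1)] [cup (i + 1), cross (!b) i]
  | slideCap (b : Bool) (i : ℕ) : LocalMove [cross b (i + 1), cap i] [cross (!b) i, cap (i + 1)]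
  /-- first Reidemeister move -/
  | reidemeister₁Cup (b : Bool) (i : ℕ) : LocalMove [cup i, cross b i] [cup i]
  | reidemeister₁Cap (b : Bool) (i : ℕ) : LocalMove [cross b i, cap i] [cap i]
  /-- second Reidemeister move -/
  | reidemeister₂ (b : Bool) (i : ℕ) : LocalMove [cross b i, cross (!b) i] []
  /-- third Reidemeister move -/
  | reidemeister₃ (b : Bool) (i : ℕ) :
      LocalMove [cross b i, cross b (i + 1), cross b i]
        [cross b (i + 1), cross b i, cross b (i + 1)]

/-- `E` arises from `D` by a single move. -/
def LinkDiagram.Move (D E : LinkDiagram) : Prop :=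
  ∃ u v a b : List Slice, LocalMove a b ∧ D.word = u ++ a ++ v ∧ E.word = u ++ b ++ v

/-- Two diagrams are isotopic if they are related by a finite sequence of moves and inverses of
moves. -/
def LinkDiagram.Isotopic : LinkDiagram → LinkDiagram → Prop :=
  Relation.EqvGen LinkDiagram.Move

/-- A knot diagram is a link diagram with a single component. -/
def KnotDiagram : Type := {D : LinkDiagram // D.components = 1}

instance KnotDiagram.setoid : Setoid KnotDiagram where
  r D E := D.1.Isotopic E.1
  iseqv :=
    ⟨fun D => Relation.EqvGen.refl D.1, fun h => Relation.EqvGen.symm _ _ h,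
      fun h h' => Relation.EqvGen.trans _ _ _ h h'⟩

/-- A knot is an isotopy class of knot diagrams. -/
def Knot : Type := Quotient KnotDiagram.setoid

/-- `D` is a diagram of the knot `K`. -/
def KnotDiagram.Represents (D : KnotDiagram) (K : Knot) : Prop :=
  (Quotient.mk KnotDiagram.setoid D : Knot) = K

namespace Knot

/-- A knot is trivial if it has a diagram without crossings. -/
def IsTrivial (K : Knot) : Prop :=
  ∃ D : KnotDiagram, D.Represents K ∧ D.1.crossings = 0

/-- The minimal crossing number `c(K)`. -/
noncomputable def crossingNumber (K : Knot) : ℕ :=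
  sInf {n : ℕ | ∃ D : KnotDiagram, D.Represents K ∧ n = D.1.crossings}

/-- The canonical genus: the minimum of `g(D)` over all diagrams `D` of `K`.  (A knot diagram has
exactly two orientations, which give the same genus.) -/
noncomputable def canonicalGenus (K : Knot) : ℕ :=
  sInf {n : ℕ | ∃ D : KnotDiagram, D.Represents K ∧ ∃ o : D.1.Orientation, n = D.1.genus o}

end Knot

/-! Whitehead doubles -/

/-- Every strand of the slice is replaced by two parallel strands in the plane (blackboard
parallels); a crossing gives rise to four crossings. -/
def Slice.double : Slice → List Slice
  | ⟨.cup, i⟩ => [cup (2 * i), cup (2 * i + 1)]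
  | ⟨.cap, i⟩ => [cap (2 * i + 1), cap (2 * i)]
  | ⟨.crossing b, i⟩ =>
      [cross b (2 * i + 1), cross b (2 * i), cross b (2 * i + 2), cross b (2 * i + 1)]

/-- Blackboard doubling of a diagram. -/
def double (w : List Slice) : List Slice := w.flatMap Slice.double

/-- A clasp in the parallel strands at positions `p` and `p + 1`: the two strands coming from below
are joined by a maximum, the two going upwards by a minimum, and these two arcs are hooked into
each other.  The Boolean distinguishes the two clasps. -/
def clasp (b : Bool) (p : ℕ) : List Slice :=
  [cup (p + 1), cross b p, cross b (p + 2), cap (p + 1)]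

/-- `n` full twists of the strands at positions `p` and `p + 1`, in the direction given by the
sign of `n`. -/
def twists (n : ℤ) (p : ℕ) : List Slice :=
  List.replicate (2 * n.natAbs) (cross (decide (0 < n)) p)

/-- `W` is a Whitehead double of `K`: it has a diagram that arises from a diagram of `K` by doubling
all strands, and inserting a clasp (of either sign) and `n` full twists, for some integer `n`, into
the two parallel strands that have replaced some strand (the one at position `j` and at the height
at which `D` is split into `u` and `v`).  The integer `n` is counted relative to the blackboard
framing, so that the possible `n` yield all twisted doubles and the untwisted one. -/
def IsWhiteheadDouble (W K : Knot) : Prop :=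
  ∃ D E : KnotDiagram, D.Represents K ∧ E.Represents W ∧
    ∃ (u v : List Slice) (j : ℕ) (b : Bool) (n : ℤ),
      D.1.word = u ++ v ∧ j < width D.1.word u.length ∧
      E.1.word = double u ++ clasp b (2 * j) ++ twists n (2 * j) ++ double v

end KnotTheory

namespace KnotTheory

/-! Stacking and shifting words -/

/-! The idea is to bring every Whitehead double of `K` into a special position over a minimal
diagram of `K`, and to count Seifert circles there.

Let `W` come from some diagram of `K` by doubling and inserting a bead, that is, a clasp followed by
full twists. The bead can be slid along the doubled knot through minima, maxima and crossings
(`Slides`, `slides_bead`), so its place is immaterial. Moves of the underlying diagram lift to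
isotopies of the doubled diagram (`eqv_double_of_localMove`), except that a first Reidemeister move
creates a full twist, which the bead absorbs. Hence `W` also arises from a diagram of `K` with the
minimal number `c` of crossings, with another number `n` of twists
(`LinkDiagram.Isotopic.exists_eqv`). The sequence of moves runs through link diagrams, so that being
a knot has to be shown invariant as well; this is done with two-valued labellings that are constant
along strands (`LinkDiagram.connected_iff`).

Since `K` is nontrivial, the minimal diagram has a crossing. The bead is put in front of it and its
twists are pushed under or over one strand of the other band, into the middle of the four crossings
(`eqv_twistedCross`). The position matters: the two strands of a band are antiparallel and border
different regions, so that twists in the open band would fuse the Seifert circles of two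
neighbouring regions, whereas in the middle both strands already lie on one circle, and each twist
crossing adds a circle.

The diagram obtained has `4c + 2 + 2|n|` crossings. Its Seifert circles run along the `c + 2`
regions of the minimal diagram, and there is one more in the middle of each doubled crossing, one in
the clasp and one for each of the `2|n|` twist crossings: `2c + 3 + 2|n|` in all, whence genus `c`.
Formally, the circles are counted from below by labellings built slice by slice (`Coloured`,
`LinkDiagram.exists_orientation`). This count falls short by one, which the rounding in the genus
absorbs. -/

theorem fits_append {u v : List Slice} {n m : ℕ} :
    Fits n (u ++ v) m ↔ ∃ k, Fits n u k ∧ Fits k v m := by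
  induction u generalizing n with
  | nil => simp [Fits]
  | cons s u ih => simp [Fits, ih, and_assoc]

theorem Fits.append {u v : List Slice} {n k m : ℕ} (hu : Fits n u k) (hv : Fits k v m) :
    Fits n (u ++ v) m :=
  fits_append.2 ⟨k, hu, hv⟩

theorem Fits.unique {w : List Slice} {n m m' : ℕ} (h : Fits n w m) (h' : Fits n w m') : m = m' := by
  induction w generalizing n with
  | nil => exact h.symm.trans h'
  | cons s w ih => exact ih h.2 h'.2

/-- The slices of `w` can be stacked on top of `n` strands. -/
def admissible : ℕ → List Slice → Bool
  | _, [] => true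
  | n, s :: w => Nat.ble (s.pos + s.piece.ins) n && admissible (s.out n) w

/-- The Boolean form lets `rfl` check the side conditions of the explicit rewriting steps, even for
a variable crossing sign, because only positions and arities enter. -/
theorem admissible_iff {w : List Slice} {n : ℕ} : admissible n w = true ↔ ∃ m, Fits n w m := by
  induction w generalizing n with
  | nil => simp [admissible, Fits]
  | cons s w ih => simp [admissible, Fits, ih, Nat.ble_eq]

theorem Fits.admissible {w : List Slice} {n m : ℕ} (h : Fits n w m) : admissible n w = true :=
  admissible_iff.2 ⟨m, h⟩

/-- The word `w` with `p` additional vertical strands to its left. -/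
def shift (p : ℕ) (w : List Slice) : List Slice := w.map fun s => ⟨s.piece, p + s.pos⟩

@[simp] theorem shift_append (p : ℕ) (u v : List Slice) :
    shift p (u ++ v) = shift p u ++ shift p v := List.map_append

@[simp] theorem shift_nil (p : ℕ) : shift p [] = [] := rfl

@[simp] theorem shift_cons (p : ℕ) (s : Slice) (w : List Slice) :
    shift p (s :: w) = ⟨s.piece, p + s.pos⟩ :: shift p w := rfl

theorem shift_shift (p q : ℕ) (w : List Slice) : shift p (shift q w) = shift (p + q) w := by
  simp [shift, Nat.add_assoc]

theorem Slice.out_add (s : Slice) {n : ℕ} (h : s.pos + s.piece.ins ≤ n) (p r : ℕ) :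
    Slice.out ⟨s.piece, p + s.pos⟩ (p + n + r) = p + s.out n + r := by
  simp only [Slice.out]; omega

theorem Fits.shift {w : List Slice} {n m : ℕ} (h : Fits n w m) (p r : ℕ) :
    Fits (p + n + r) (KnotTheory.shift p w) (p + m + r) := by
  induction w generalizing n with
  | nil => obtain rfl : n = m := h; rfl
  | cons s w ih =>
    refine ⟨?_, ?_⟩
    · have := h.1; simp only; omega
    · rw [Slice.out_add s h.1]; exact ih h.2

theorem Fits.widen {w : List Slice} {n m : ℕ} (h : Fits n w m) (r : ℕ) : Fits (n + r) w (m + r) := by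
  have := h.shift 0 r
  simpa [KnotTheory.shift] using this

/-! Isotopies of words -/

theorem LocalMove.fits {a b : List Slice} (h : LocalMove a b) {n m : ℕ} (ha : Fits n a m) :
    Fits n b m := by
  cases h
  case exchange a b i d =>
    simp only [Fits, Slice.out] at ha ⊢
    omega
  all_goals
    simp only [Fits, Slice.out, Piece.ins, Piece.outs] at ha ⊢
    omega

theorem LocalMove.shift {a b : List Slice} (h : LocalMove a b) (p : ℕ) :
    LocalMove (shift p a) (shift p b) := by
  cases h with
  | exchange a b i d =>
    have := LocalMove.exchange a b (p + i) d
    simpa [Nat.add_assoc] using this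
  | zigzag i => exact .zigzag (p + i)
  | zagzig i => exact .zagzig (p + i)
  | slideCup b i => exact .slideCup b (p + i)
  | slideCap b i => exact .slideCap b (p + i)
  | reidemeister₁Cup b i => exact .reidemeister₁Cup b (p + i)
  | reidemeister₁Cap b i => exact .reidemeister₁Cap b (p + i)
  | reidemeister₂ b i => exact .reidemeister₂ b (p + i)
  | reidemeister₃ b i => exact .reidemeister₃ b (p + i)

/-- A move inside a word that is stacked on top of `n` strands. -/
def WordMove (n : ℕ) (w w' : List Slice) : Prop :=
  ∃ (u a b v : List Slice) (k m : ℕ), LocalMove a b ∧ Fits n u k ∧ Fits k a m ∧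
    w = u ++ a ++ v ∧ w' = u ++ b ++ v

/-- Isotopy of words that are stacked on top of `n` strands. -/
def Eqv (n : ℕ) : List Slice → List Slice → Prop := Relation.EqvGen (WordMove n)

namespace Eqv

@[refl] theorem refl {n : ℕ} (w : List Slice) : Eqv n w w := Relation.EqvGen.refl w

@[symm] theorem symm {n : ℕ} {a b : List Slice} (h : Eqv n a b) : Eqv n b a :=
  Relation.EqvGen.symm _ _ h

@[trans] theorem trans {n : ℕ} {a b c : List Slice} (h : Eqv n a b) (h' : Eqv n b c) : Eqv n a c :=
  Relation.EqvGen.trans _ _ _ h h'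

theorem of_localMove {n m : ℕ} {a b : List Slice} (h : LocalMove a b) (ha : Fits n a m) :
    Eqv n a b :=
  .rel _ _ ⟨[], a, b, [], n, m, h, rfl, ha, by simp, by simp⟩

theorem map {n n' : ℕ} {f : List Slice → List Slice}
    (hf : ∀ a b, WordMove n a b → WordMove n' (f a) (f b)) {a b : List Slice} (h : Eqv n a b) :
    Eqv n' (f a) (f b) := by
  induction h with
  | rel a b h => exact .rel _ _ (hf a b h)
  | refl a => exact refl _
  | symm a b _ ih => exact ih.symm
  | trans a b c _ _ ih ih' => exact ih.trans ih'

theorem append {n : ℕ} {a b : List Slice} (h : Eqv n a b) (v : List Slice) :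
    Eqv n (a ++ v) (b ++ v) := by
  refine h.map (f := (· ++ v)) ?_
  rintro _ _ ⟨u, a, b, v', k, m, h, hu, ha, rfl, rfl⟩
  exact ⟨u, a, b, v' ++ v, k, m, h, hu, ha, by simp, by simp⟩

theorem prepend {n k : ℕ} {u a b : List Slice} (hu : Fits n u k) (h : Eqv k a b) :
    Eqv n (u ++ a) (u ++ b) := by
  refine h.map (f := (u ++ ·)) ?_
  rintro _ _ ⟨u', a, b, v', k', m, h, hu', ha, rfl, rfl⟩
  exact ⟨u ++ u', a, b, v', k', m, h, hu.append hu', ha, by simp, by simp⟩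

theorem ctx {n k : ℕ} {u a b : List Slice} (hu : Fits n u k) (h : Eqv k a b) (v : List Slice) :
    Eqv n (u ++ a ++ v) (u ++ b ++ v) :=
  (prepend hu h).append v

theorem shift {n : ℕ} {a b : List Slice} (h : Eqv n a b) (p r : ℕ) :
    Eqv (p + n + r) (shift p a) (shift p b) := by
  refine h.map (f := KnotTheory.shift p) ?_
  rintro _ _ ⟨u, a, b, v', k, m, h, hu, ha, rfl, rfl⟩
  exact ⟨_, _, _, KnotTheory.shift p v', _, _, h.shift p, hu.shift p r, ha.shift p r, by simp, by simp⟩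

theorem widen {n : ℕ} {a b : List Slice} (h : Eqv n a b) (r : ℕ) : Eqv (n + r) a b := by
  have := h.shift 0 r
  simpa [KnotTheory.shift] using this

theorem fits_iff {n m : ℕ} {a b : List Slice} (h : Eqv n a b) : Fits n a m ↔ Fits n b m := by
  induction h with
  | rel a b h =>
    obtain ⟨u, a, b, v, k, m', h, hu, ha, rfl, rfl⟩ := h
    simp only [fits_append]
    constructor <;> rintro ⟨l, ⟨k', hu', ha'⟩, hv⟩
    · exact ⟨l, ⟨k', hu', h.fits ha'⟩, hv⟩
    · obtain rfl := hu.unique hu'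
      obtain rfl := (h.fits ha).unique ha'
      exact ⟨_, ⟨_, hu, ha⟩, hv⟩
  | refl a => rfl
  | symm a b _ ih => exact ih.symm
  | trans a b c _ _ ih ih' => exact ih.trans ih'

/-- All intermediate words of the isotopy close up by `fits_iff`, so each of them is a link diagram.
-/
theorem isotopic {w w' : List Slice} (h : Eqv 0 w w') :
    ∀ D E : LinkDiagram, D.word = w → E.word = w' → D.Isotopic E := by
  induction h with
  | rel a b h =>
    rintro D E rfl rfl
    obtain ⟨u, a, b, v, k, m, h, hu, ha, h1, h2⟩ := h
    exact .rel _ _ ⟨u, v, a, b, h, h1, h2⟩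
  | refl a =>
    rintro ⟨_, _⟩ ⟨_, _⟩ rfl rfl
    exact .refl _
  | symm a b _ ih => exact fun D E hD hE => .symm _ _ (ih E D hE hD)
  | trans a b c hab _ ih ih' =>
    intro D E hD hE
    let F : LinkDiagram := ⟨b, (Eqv.fits_iff hab).1 (hD ▸ D.closed)⟩
    exact .trans _ F _ (ih D F hD rfl) (ih' F E rfl hE)

end Eqv

/-! Rules for rewriting words -/

/-- The words `a` and `b` are isotopic wherever both of them fit. -/
def Rule (a b : List Slice) : Prop :=
  ∀ n, admissible n a = true → admissible n b = true → Eqv n a b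

namespace Rule

theorem of_localMove {a b : List Slice} (h : LocalMove a b) : Rule a b := fun _ ha _ =>
  (admissible_iff.1 ha).elim fun _ ha => .of_localMove h ha

theorem symm {a b : List Slice} (h : Rule a b) : Rule b a := fun n ha hb => (h n hb ha).symm

theorem exchange (a b : Piece) (i d : ℕ) :
    Rule [⟨a, i⟩, ⟨b, i + a.outs + d⟩] [⟨b, i + a.ins + d⟩, ⟨a, i⟩] :=
  of_localMove (.exchange a b i d)

theorem zigzag (i : ℕ) : Rule [cup i, cap (i + 1)] [] := of_localMove (.zigzag i)

theorem zagzig (i : ℕ) : Rule [cup (i + 1), cap i] [] := of_localMove (.zagzig i)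

theorem slideCup (b : Bool) (i : ℕ) :
    Rule [cup i, cross b (i + 1)] [cup (i + 1), cross (!b) i] := of_localMove (.slideCup b i)

theorem slideCup' (b : Bool) (i : ℕ) :
    Rule [cup i, cross (!b) (i + 1)] [cup (i + 1), cross b i] := by
  simpa using slideCup (!b) i

theorem slideCap (b : Bool) (i : ℕ) :
    Rule [cross b (i + 1), cap i] [cross (!b) i, cap (i + 1)] := of_localMove (.slideCap b i)

theorem slideCap' (b : Bool) (i : ℕ) :
    Rule [cross (!b) (i + 1), cap i] [cross b i, cap (i + 1)] := by
  simpa using slideCap (!b) i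

theorem reidemeister₁Cup (b : Bool) (i : ℕ) : Rule [cup i, cross b i] [cup i] :=
  of_localMove (.reidemeister₁Cup b i)

theorem reidemeister₁Cap (b : Bool) (i : ℕ) : Rule [cross b i, cap i] [cap i] :=
  of_localMove (.reidemeister₁Cap b i)

theorem reidemeister₂ (b : Bool) (i : ℕ) : Rule [cross b i, cross (!b) i] [] :=
  of_localMove (.reidemeister₂ b i)

theorem reidemeister₂' (b : Bool) (i : ℕ) : Rule [cross (!b) i, cross b i] [] := by
  simpa using reidemeister₂ (!b) i

end Rule

/-- Application of a rule inside a word. -/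
theorem Eqv.step {n : ℕ} (u : List Slice) {a b : List Slice} (h : Rule a b) (v : List Slice)
    (ha : admissible n (u ++ a) = true) (hb : admissible n (u ++ b) = true) :
    Eqv n (u ++ a ++ v) (u ++ b ++ v) := by
  obtain ⟨m, hm⟩ := admissible_iff.1 ha
  obtain ⟨m', hm'⟩ := admissible_iff.1 hb
  obtain ⟨k, hu, ha⟩ := fits_append.1 hm
  obtain ⟨k', hu', hb⟩ := fits_append.1 hm'
  obtain rfl := hu.unique hu'
  exact .ctx hu (h k ha.admissible hb.admissible) v

/-- An isotopy of concrete words may be applied to the right of any number of strands. -/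
theorem Rule.of_eqv {n : ℕ} {a b : List Slice} (h : Eqv n a b)
    (hs : ∀ k p, admissible k (shift p a) = true → p + n ≤ k) (p : ℕ) :
    Rule (shift p a) (shift p b) := by
  intro k ha _
  obtain ⟨r, rfl⟩ := Nat.exists_eq_add_of_le (hs k p ha)
  exact h.shift p r

/-- Third Reidemeister move: a strand passes over or under a crossing, from left to right. -/
theorem Rule.passRight (x y : Bool) (i : ℕ) :
    Rule [cross x i, cross x (i + 1), cross y i] [cross y (i + 1), cross x i, cross x (i + 1)] := by
  refine Rule.of_eqv (n := 3) (a := [cross x 0, cross x 1, cross y 0])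
    (b := [cross y 1, cross x 0, cross x 1]) ?_ (fun k p h => ?_) i
  · obtain rfl | rfl : y = x ∨ y = !x := by cases x <;> cases y <;> simp
    · exact .of_localMove (m := 3) (.reidemeister₃ _ 0) (by simp [Fits, Slice.out, Piece.ins, Piece.outs])
    -- For mixed signs, the available third move is conjugated: a cancelling pair is created at the
    -- bottom, the move is applied backwards, and the pair at the top cancels.
    · exact ((Eqv.step [] (reidemeister₂' x 1).symm [cross x 0, cross x 1, cross (!x) 0]
        rfl rfl).trans (Eqv.step [cross (!x) 1] (Rule.of_localMove (.reidemeister₃ x 0)).symm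
          [cross (!x) 0] rfl rfl)).trans (Eqv.step [cross (!x) 1, cross x 0, cross x 1]
            (reidemeister₂ x 0) [] rfl rfl)
  · simp [admissible, Slice.out, Piece.ins, Piece.outs] at h
    omega

/-- Third Reidemeister move: a strand passes over or under a crossing, from right to left. -/
theorem Rule.passLeft (x y : Bool) (i : ℕ) :
    Rule [cross x i, cross y (i + 1), cross y i] [cross y (i + 1), cross y i, cross x (i + 1)] := by
  refine Rule.of_eqv (n := 3) (a := [cross x 0, cross y 1, cross y 0])
    (b := [cross y 1, cross y 0, cross x 1]) ?_ (fun k p h => ?_) i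
  · obtain rfl | rfl : x = y ∨ x = !y := by cases x <;> cases y <;> simp
    · exact .of_localMove (m := 3) (.reidemeister₃ _ 0) (by simp [Fits, Slice.out, Piece.ins, Piece.outs])
    · exact ((Eqv.step [cross (!y) 0, cross y 1, cross y 0] (reidemeister₂ y 1).symm []
        rfl rfl).trans (Eqv.step [cross (!y) 0] (Rule.of_localMove (.reidemeister₃ y 0)).symm
          [cross (!y) 1] rfl rfl)).trans (Eqv.step []
            (reidemeister₂' y 0) [cross y 1, cross y 0, cross (!y) 1] rfl rfl)
  · simp [admissible, Slice.out, Piece.ins, Piece.outs] at h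
    omega


/-! Isotopies of doubled words -/

/-- A crossing of parallel strands slides over a local minimum. -/
theorem eqv_cup_cross (b : Bool) :
    Eqv 0 ([cup 0, cup 1] ++ [cross b 0])
      ([cup 0, cup 1] ++ [cross b 2]) :=
  .trans (.step [cup 0] (Rule.slideCup' b 0).symm [] rfl rfl) <|
  .trans (.step [] (Rule.exchange .cup .cup 0 0).symm [cross (!b) 1] rfl rfl) <|
  .step [cup 0] (Rule.slideCup b 1).symm [] rfl rfl

/-- A crossing of parallel strands slides over a local maximum. -/
theorem eqv_cap_cross (b : Bool) :
    Eqv 4 ([cross b 0] ++ [cap 1, cap 0])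
      ([cross b 2] ++ [cap 1, cap 0]) :=
  .trans (.step [] (Rule.slideCap' b 0).symm [cap 0] rfl rfl) <|
  .trans (.step [cross (!b) 1] (.exchange .cap .cap 0 0) [] rfl rfl) <|
  .step [] (Rule.slideCap b 1).symm [cap 0] rfl rfl

/-- A clasp slides over a local minimum. -/
theorem eqv_cup_clasp (b : Bool) :
    Eqv 0 ([cup 0, cup 1] ++ clasp b 0)
      ([cup 0, cup 1] ++ clasp b 2) :=
  .trans (.step [cup 0] (Rule.exchange .cup .cup 1 0).symm [cross b 0, cross b 2, cap 1] rfl rfl) <|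
  .trans (.step [cup 0, cup 1] (Rule.exchange (.crossing b) .cup 0 1).symm [cross b 2, cap 1] rfl rfl) <|
  .trans (.step [cup 0] (Rule.slideCup' b 0).symm [cup 3, cross b 2, cap 1] rfl rfl) <|
  .trans (.step [] (Rule.exchange .cup .cup 0 0).symm [cross (!b) 1, cup 3, cross b 2, cap 1] rfl rfl) <|
  .trans (.step [cup 0, cup 2, cross (!b) 1] (Rule.slideCup' b 2).symm [cap 1] rfl rfl) <|
  .trans (.step [cup 0, cup 2, cross (!b) 1, cup 2] (Rule.exchange .cap (.crossing !b) 1 0).symm [] rfl rfl) <|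
  .trans (.step [cup 0, cup 2, cross (!b) 1] (.zagzig 1) [cross (!b) 1] rfl rfl) <|
  .trans (.step [cup 0, cup 2, cross (!b) 1] (Rule.zigzag 2).symm [cross (!b) 1] rfl rfl) <|
  .trans (.step [cup 0, cup 2, cross (!b) 1, cup 2] (Rule.exchange (.crossing !b) .cap 1 0).symm [] rfl rfl) <|
  .trans (.step [cup 0] (Rule.slideCup b 1).symm [cup 2, cross (!b) 1, cap 3] rfl rfl) <|
  .trans (.step [cup 0, cup 1] (Rule.exchange .cup (.crossing b) 2 0).symm [cross (!b) 1, cap 3] rfl rfl) <|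
  .trans (.step [cup 0, cup 1, cup 2] (Rule.exchange (.crossing !b) (.crossing b) 1 1).symm [cap 3] rfl rfl) <|
  .trans (.step [cup 0, cup 1] (Rule.slideCup b 1).symm [cross b 4, cap 3] rfl rfl) <|
  .step [cup 0] (Rule.exchange .cup .cup 1 0).symm [cross b 2, cross b 4, cap 3] rfl rfl

/-- A clasp slides over a local maximum. -/
theorem eqv_cap_clasp (b : Bool) :
    Eqv 4 (clasp b 0 ++ [cap 1, cap 0])
      (clasp b 2 ++ [cap 1, cap 0]) :=
  .trans (.step [cup 1] (.exchange (.crossing b) (.crossing b) 0 0) [cap 1, cap 1, cap 0] rfl rfl) <|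
  .trans (.step [] (.slideCup b 1) [cross b 0, cap 1, cap 1, cap 0] rfl rfl) <|
  .trans (.step [cup 2, cross (!b) 1] (Rule.slideCap' b 0).symm [cap 1, cap 0] rfl rfl) <|
  .trans (.step [cup 2, cross (!b) 1, cross (!b) 1] (.exchange .cap .cap 0 1) [cap 0] rfl rfl) <|
  .trans (.step [cup 2, cross (!b) 1] (.exchange (.crossing !b) .cap 1 0) [cap 0, cap 0] rfl rfl) <|
  .trans (.step [cup 2] (.exchange (.crossing !b) .cap 1 0) [cross (!b) 1, cap 0, cap 0] rfl rfl) <|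
  .trans (.step [] (.zigzag 2) [cross (!b) 1, cross (!b) 1, cap 0, cap 0] rfl rfl) <|
  .trans (.step [cross (!b) 1, cross (!b) 1] (.exchange .cap .cap 0 0) [] rfl rfl) <|
  .trans (.step [] (Rule.zagzig 1).symm [cross (!b) 1, cross (!b) 1, cap 2, cap 0] rfl rfl) <|
  .trans (.step [cup 2] (.exchange .cap (.crossing !b) 1 0) [cross (!b) 1, cap 2, cap 0] rfl rfl) <|
  .trans (.step [cup 2, cross (!b) 3] (.exchange .cap (.crossing !b) 1 0) [cap 2, cap 0] rfl rfl) <|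
  .trans (.step [cup 2, cross (!b) 3, cross (!b) 3] (.exchange .cap .cap 1 1) [cap 0] rfl rfl) <|
  .trans (.step [cup 2, cross (!b) 3] (Rule.slideCap b 3).symm [cap 1, cap 0] rfl rfl) <|
  .step [] (.slideCup' b 2) [cross b 4, cap 3, cap 1, cap 0] rfl rfl

/-- A strand passes over or under a clasp, from left to right. -/
theorem eqv_clasp_right_same (b : Bool) :
    Eqv 3 (clasp b 1 ++ [cross b 0, cross b 1])
      ([cross b 0, cross b 1] ++ clasp b 0) :=
  .trans (.step [cup 2, cross b 1, cross b 3] (Rule.exchange (.crossing b) .cap 0 0).symm [cross b 1] rfl rfl) <|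
  .trans (.step [cup 2, cross b 1] (Rule.exchange (.crossing b) (.crossing b) 0 1).symm [cap 2, cross b 1] rfl rfl) <|
  .trans (.step [] (Rule.reidemeister₂ b 0).symm [cup 2, cross b 1, cross b 0, cross b 3, cap 2, cross b 1] rfl rfl) <|
  .trans (.step [cross b 0] (.exchange (.crossing !b) .cup 0 0) [cross b 1, cross b 0, cross b 3, cap 2, cross b 1] rfl rfl) <|
  .trans (.step [cross b 0, cup 2] (.passLeft (!b) b 0) [cross b 3, cap 2, cross b 1] rfl rfl) <|
  .trans (.step [cross b 0] (Rule.slideCup' b 1).symm [cross b 0, cross (!b) 1, cross b 3, cap 2, cross b 1] rfl rfl) <|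
  .trans (.step [cross b 0, cup 1] (Rule.exchange (.crossing b) (.crossing !b) 0 0).symm [cross (!b) 1, cross b 3, cap 2, cross b 1] rfl rfl) <|
  .trans (.step [cross b 0, cup 1, cross b 0, cross (!b) 2] (.exchange (.crossing !b) (.crossing b) 1 0) [cap 2, cross b 1] rfl rfl) <|
  .trans (.step [cross b 0, cup 1, cross b 0, cross (!b) 2, cross b 3] (Rule.slideCap b 1).symm [cross b 1] rfl rfl) <|
  .trans (.step [cross b 0, cup 1, cross b 0, cross (!b) 2, cross b 3, cross b 2] (.exchange .cap (.crossing b) 1 0) [] rfl rfl) <|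
  .trans (.step [cross b 0, cup 1, cross b 0, cross (!b) 2] (Rule.passRight b b 2).symm [cap 1] rfl rfl) <|
  .trans (.step [cross b 0, cup 1, cross b 0] (.reidemeister₂' b 2) [cross b 3, cross b 2, cap 1] rfl rfl) <|
  .trans (.step [cross b 0, cup 1] (.exchange (.crossing b) (.crossing b) 0 1) [cross b 2, cap 1] rfl rfl) <|
  .step [cross b 0] (.exchange .cup (.crossing b) 1 0) [cross b 0, cross b 2, cap 1] rfl rfl

/-- A strand passes over or under a clasp, from right to left. -/
theorem eqv_clasp_left_same (b : Bool) :
    Eqv 3 (clasp b 0 ++ [cross b 1, cross b 0])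
      ([cross b 1, cross b 0] ++ clasp b 1) :=
  .trans (.step [cup 1, cross b 0, cross b 2] (.exchange .cap (.crossing b) 1 0) [cross b 0] rfl rfl) <|
  .trans (.step [] (Rule.reidemeister₂ b 1).symm [cup 1, cross b 0, cross b 2, cross b 3, cap 1, cross b 0] rfl rfl) <|
  .trans (.step [cross b 1] (Rule.exchange .cup (.crossing !b) 1 0).symm [cross b 0, cross b 2, cross b 3, cap 1, cross b 0] rfl rfl) <|
  .trans (.step [cross b 1, cup 1] (Rule.exchange (.crossing b) (.crossing !b) 0 1).symm [cross b 2, cross b 3, cap 1, cross b 0] rfl rfl) <|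
  .trans (.step [cross b 1, cup 1, cross b 0] (Rule.passRight b (!b) 2).symm [cap 1, cross b 0] rfl rfl) <|
  .trans (.step [cross b 1, cup 1] (.exchange (.crossing b) (.crossing b) 0 0) [cross b 3, cross (!b) 2, cap 1, cross b 0] rfl rfl) <|
  .trans (.step [cross b 1] (.slideCup b 1) [cross b 0, cross b 3, cross (!b) 2, cap 1, cross b 0] rfl rfl) <|
  .trans (.step [cross b 1, cup 2, cross (!b) 1, cross b 0, cross b 3] (.slideCap' b 1) [cross b 0] rfl rfl) <|
  .trans (.step [cross b 1, cup 2, cross (!b) 1, cross b 0, cross b 3, cross b 1] (Rule.exchange (.crossing b) .cap 0 0).symm [] rfl rfl) <|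
  .trans (.step [cross b 1, cup 2, cross (!b) 1, cross b 0] (Rule.exchange (.crossing b) (.crossing b) 1 0).symm [cross b 0, cap 2] rfl rfl) <|
  .trans (.step [cross b 1, cup 2, cross (!b) 1, cross b 0, cross b 1] (Rule.exchange (.crossing b) (.crossing b) 0 1).symm [cap 2] rfl rfl) <|
  .trans (.step [cross b 1, cup 2, cross (!b) 1] (.passRight b b 0) [cross b 3, cap 2] rfl rfl) <|
  .trans (.step [cross b 1, cup 2] (.reidemeister₂' b 1) [cross b 0, cross b 1, cross b 3, cap 2] rfl rfl) <|
  .step [cross b 1] (Rule.exchange (.crossing b) .cup 0 0).symm [cross b 1, cross b 3, cap 2] rfl rfl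

/-- A strand passes over or under a clasp, from left to right. -/
theorem eqv_clasp_right_opposite (b : Bool) :
    Eqv 3 (clasp (!b) 1 ++ [cross b 0, cross b 1])
      ([cross b 0, cross b 1] ++ clasp (!b) 0) :=
  .trans (.step [cup 2, cross (!b) 1, cross (!b) 3] (Rule.exchange (.crossing b) .cap 0 0).symm [cross b 1] rfl rfl) <|
  .trans (.step [cup 2, cross (!b) 1] (Rule.exchange (.crossing b) (.crossing !b) 0 1).symm [cap 2, cross b 1] rfl rfl) <|
  .trans (.step [] (Rule.reidemeister₂ b 0).symm [cup 2, cross (!b) 1, cross b 0, cross (!b) 3, cap 2, cross b 1] rfl rfl) <|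
  .trans (.step [cross b 0] (.exchange (.crossing !b) .cup 0 0) [cross (!b) 1, cross b 0, cross (!b) 3, cap 2, cross b 1] rfl rfl) <|
  .trans (.step [cross b 0, cup 2] (.passRight (!b) b 0) [cross (!b) 3, cap 2, cross b 1] rfl rfl) <|
  .trans (.step [cross b 0] (Rule.slideCup' b 1).symm [cross (!b) 0, cross (!b) 1, cross (!b) 3, cap 2, cross b 1] rfl rfl) <|
  .trans (.step [cross b 0, cup 1] (Rule.exchange (.crossing !b) (.crossing !b) 0 0).symm [cross (!b) 1, cross (!b) 3, cap 2, cross b 1] rfl rfl) <|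
  .trans (.step [cross b 0, cup 1, cross (!b) 0, cross (!b) 2] (.exchange (.crossing !b) (.crossing !b) 1 0) [cap 2, cross b 1] rfl rfl) <|
  .trans (.step [cross b 0, cup 1, cross (!b) 0, cross (!b) 2, cross (!b) 3] (Rule.slideCap b 1).symm [cross b 1] rfl rfl) <|
  .trans (.step [cross b 0, cup 1, cross (!b) 0, cross (!b) 2, cross (!b) 3, cross b 2] (.exchange .cap (.crossing b) 1 0) [] rfl rfl) <|
  .trans (.step [cross b 0, cup 1, cross (!b) 0, cross (!b) 2] (Rule.passRight b (!b) 2).symm [cap 1] rfl rfl) <|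
  .trans (.step [cross b 0, cup 1, cross (!b) 0] (.reidemeister₂' b 2) [cross b 3, cross (!b) 2, cap 1] rfl rfl) <|
  .trans (.step [cross b 0, cup 1] (.exchange (.crossing !b) (.crossing b) 0 1) [cross (!b) 2, cap 1] rfl rfl) <|
  .step [cross b 0] (.exchange .cup (.crossing b) 1 0) [cross (!b) 0, cross (!b) 2, cap 1] rfl rfl

/-- A strand passes over or under a clasp, from right to left. -/
theorem eqv_clasp_left_opposite (b : Bool) :
    Eqv 3 (clasp (!b) 0 ++ [cross b 1, cross b 0])
      ([cross b 1, cross b 0] ++ clasp (!b) 1) :=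
  .trans (.step [cup 1, cross (!b) 0, cross (!b) 2] (.exchange .cap (.crossing b) 1 0) [cross b 0] rfl rfl) <|
  .trans (.step [] (Rule.reidemeister₂ b 1).symm [cup 1, cross (!b) 0, cross (!b) 2, cross b 3, cap 1, cross b 0] rfl rfl) <|
  .trans (.step [cross b 1] (Rule.exchange .cup (.crossing !b) 1 0).symm [cross (!b) 0, cross (!b) 2, cross b 3, cap 1, cross b 0] rfl rfl) <|
  .trans (.step [cross b 1, cup 1] (Rule.exchange (.crossing !b) (.crossing !b) 0 1).symm [cross (!b) 2, cross b 3, cap 1, cross b 0] rfl rfl) <|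
  .trans (.step [cross b 1, cup 1, cross (!b) 0] (Rule.passLeft b (!b) 2).symm [cap 1, cross b 0] rfl rfl) <|
  .trans (.step [cross b 1, cup 1] (.exchange (.crossing !b) (.crossing b) 0 0) [cross (!b) 3, cross (!b) 2, cap 1, cross b 0] rfl rfl) <|
  .trans (.step [cross b 1] (.slideCup b 1) [cross (!b) 0, cross (!b) 3, cross (!b) 2, cap 1, cross b 0] rfl rfl) <|
  .trans (.step [cross b 1, cup 2, cross (!b) 1, cross (!b) 0, cross (!b) 3] (.slideCap' b 1) [cross b 0] rfl rfl) <|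
  .trans (.step [cross b 1, cup 2, cross (!b) 1, cross (!b) 0, cross (!b) 3, cross b 1] (Rule.exchange (.crossing b) .cap 0 0).symm [] rfl rfl) <|
  .trans (.step [cross b 1, cup 2, cross (!b) 1, cross (!b) 0] (Rule.exchange (.crossing b) (.crossing !b) 1 0).symm [cross b 0, cap 2] rfl rfl) <|
  .trans (.step [cross b 1, cup 2, cross (!b) 1, cross (!b) 0, cross b 1] (Rule.exchange (.crossing b) (.crossing !b) 0 1).symm [cap 2] rfl rfl) <|
  .trans (.step [cross b 1, cup 2, cross (!b) 1] (.passLeft (!b) b 0) [cross (!b) 3, cap 2] rfl rfl) <|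
  .trans (.step [cross b 1, cup 2] (.reidemeister₂' b 1) [cross b 0, cross (!b) 1, cross (!b) 3, cap 2] rfl rfl) <|
  .step [cross b 1] (Rule.exchange (.crossing b) .cup 0 0).symm [cross (!b) 1, cross (!b) 3, cap 2] rfl rfl

/-- A clasp commutes with a half twist. -/
theorem eqv_cross_clasp_same (b : Bool) :
    Eqv 2 ([cross b 0] ++ clasp b 0)
      (clasp b 0 ++ [cross b 0]) :=
  .trans (.step [cross b 0, cup 1, cross b 0] (.slideCap b 1) [] rfl rfl) <|
  .trans (.step [cross b 0] (Rule.reidemeister₁Cup b 1).symm [cross b 0, cross (!b) 1, cap 2] rfl rfl) <|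
  .trans (.step [cross b 0, cup 1] (Rule.passLeft (!b) b 0).symm [cap 2] rfl rfl) <|
  .trans (.step [cross b 0] (Rule.slideCup b 0).symm [cross b 1, cross b 0, cap 2] rfl rfl) <|
  .trans (.step [] (Rule.exchange .cup (.crossing b) 0 0).symm [cross b 1, cross b 1, cross b 0, cap 2] rfl rfl) <|
  .trans (.step [cup 0, cross b 2, cross b 1, cross b 1] (.exchange (.crossing b) .cap 0 0) [] rfl rfl) <|
  .trans (.step [cup 0, cross b 2, cross b 1] (Rule.slideCap' b 1).symm [cross b 0] rfl rfl) <|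
  .trans (.step [cup 0] (Rule.passLeft (!b) b 1).symm [cap 1, cross b 0] rfl rfl) <|
  .trans (.step [cup 0, cross (!b) 1, cross b 2] (.reidemeister₁Cap b 1) [cross b 0] rfl rfl) <|
  .step [] (.slideCup' b 0) [cross b 2, cap 1, cross b 0] rfl rfl

/-- A clasp commutes with a half twist. -/
theorem eqv_cross_clasp_opposite (b : Bool) :
    Eqv 2 ([cross b 0] ++ clasp (!b) 0)
      (clasp (!b) 0 ++ [cross b 0]) :=
  .trans (.step [cross b 0] (Rule.slideCup b 0).symm [cross (!b) 2, cap 1] rfl rfl) <|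
  .trans (.step [] (Rule.exchange .cup (.crossing b) 0 0).symm [cross b 1, cross (!b) 2, cap 1] rfl rfl) <|
  .trans (.step [cup 0] (Rule.passLeft (!b) b 1).symm [cap 1] rfl rfl) <|
  .trans (.step [cup 0, cross (!b) 1, cross b 2] (.reidemeister₁Cap b 1) [] rfl rfl) <|
  .trans (.step [cup 0, cross (!b) 1] (.slideCap b 1) [] rfl rfl) <|
  .trans (.step [] (.slideCup' b 0) [cross (!b) 1, cap 2] rfl rfl) <|
  .trans (.step [] (Rule.reidemeister₁Cup b 1).symm [cross b 0, cross (!b) 1, cap 2] rfl rfl) <|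
  .trans (.step [cup 1] (Rule.passLeft (!b) b 0).symm [cap 2] rfl rfl) <|
  .trans (.step [cup 1, cross (!b) 0, cross b 1] (.exchange (.crossing b) .cap 0 0) [] rfl rfl) <|
  .step [cup 1, cross (!b) 0] (Rule.slideCap' b 1).symm [cross b 0] rfl rfl

theorem eqv_double_zigzag  :
    Eqv 2 (double [cup 0, cap 1])
      (double []) :=
  .trans (.step [cup 0] (.exchange .cup .cap 1 0) [cap 2] rfl rfl) <|
  .trans (.step [] (.zigzag 0) [cup 1, cap 2] rfl rfl) <|
  .step [] (.zigzag 1) [] rfl rfl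

theorem eqv_double_zagzig  :
    Eqv 2 (double [cup 1, cap 0])
      (double []) :=
  .trans (.step [cup 2] (Rule.exchange .cap .cup 1 0).symm [cap 0] rfl rfl) <|
  .trans (.step [] (.zagzig 1) [cup 1, cap 0] rfl rfl) <|
  .step [] (.zagzig 0) [] rfl rfl

theorem eqv_double_slideCup (b : Bool) :
    Eqv 2 (double [cup 0, cross b 1])
      (double [cup 1, cross (!b) 0]) :=
  .trans (.step [cup 0] (.exchange .cup (.crossing b) 1 0) [cross b 2, cross b 4, cross b 3] rfl rfl) <|
  .trans (.step [cup 0, cross b 1] (.slideCup b 1) [cross b 4, cross b 3] rfl rfl) <|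
  .trans (.step [cup 0, cross b 1, cup 2] (.exchange (.crossing !b) (.crossing b) 1 1) [cross b 3] rfl rfl) <|
  .trans (.step [cup 0, cross b 1] (.exchange .cup (.crossing b) 2 0) [cross (!b) 1, cross b 3] rfl rfl) <|
  .trans (.step [cup 0, cross b 1, cross b 2, cup 2] (.exchange (.crossing !b) (.crossing b) 1 0) [] rfl rfl) <|
  .trans (.step [cup 0, cross b 1, cross b 2] (.slideCup b 2) [cross (!b) 1] rfl rfl) <|
  .trans (.step [] (.slideCup b 0) [cross b 2, cup 3, cross (!b) 2, cross (!b) 1] rfl rfl) <|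
  .trans (.step [cup 1] (.exchange (.crossing !b) (.crossing b) 0 0) [cup 3, cross (!b) 2, cross (!b) 1] rfl rfl) <|
  .trans (.step [cup 1, cross b 2] (.exchange (.crossing !b) .cup 0 1) [cross (!b) 2, cross (!b) 1] rfl rfl) <|
  .trans (.step [] (.slideCup b 1) [cup 3, cross (!b) 0, cross (!b) 2, cross (!b) 1] rfl rfl) <|
  .step [cup 2] (.exchange (.crossing !b) .cup 1 0) [cross (!b) 0, cross (!b) 2, cross (!b) 1] rfl rfl

theorem eqv_double_slideCap (b : Bool) :
    Eqv 6 (double [cross b 1, cap 0])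
      (double [cross (!b) 0, cap 1]) :=
  .trans (.step [cross b 3, cross b 2, cross b 4] (Rule.exchange .cap (.crossing b) 1 0).symm [cap 0] rfl rfl) <|
  .trans (.step [cross b 3, cross b 2] (Rule.exchange .cap (.crossing b) 1 1).symm [cross b 1, cap 0] rfl rfl) <|
  .trans (.step [cross b 3, cross b 2, cap 1, cross b 2] (.slideCap b 0) [] rfl rfl) <|
  .trans (.step [cross b 3, cross b 2, cap 1] (Rule.exchange (.crossing !b) (.crossing b) 0 0).symm [cap 1] rfl rfl) <|
  .trans (.step [cross b 3, cross b 2, cap 1, cross (!b) 0] (.slideCap b 1) [] rfl rfl) <|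
  .trans (.step [cross b 3] (.slideCap b 1) [cross (!b) 0, cross (!b) 1, cap 2] rfl rfl) <|
  .trans (.step [] (Rule.exchange (.crossing !b) (.crossing b) 1 0).symm [cap 2, cross (!b) 0, cross (!b) 1, cap 2] rfl rfl) <|
  .trans (.step [cross (!b) 1] (.slideCap b 2) [cross (!b) 0, cross (!b) 1, cap 2] rfl rfl) <|
  .trans (.step [cross (!b) 1, cross (!b) 2] (Rule.exchange (.crossing !b) .cap 0 1).symm [cross (!b) 1, cap 2] rfl rfl) <|
  .trans (.step [cross (!b) 1, cross (!b) 2, cross (!b) 0] (Rule.exchange (.crossing !b) .cap 1 0).symm [cap 2] rfl rfl) <|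
  .step [cross (!b) 1] (Rule.exchange (.crossing !b) (.crossing !b) 0 0).symm [cross (!b) 1, cap 3, cap 2] rfl rfl

/-- Doubling a curl at a local minimum gives rise to a full twist. -/
theorem eqv_double_reidemeister₁Cup (b : Bool) :
    Eqv 0 (double [cup 0, cross b 0])
      (double [cup 0] ++ [cross (!b) 0, cross (!b) 0]) :=
  .trans (.step [cup 0] (.reidemeister₁Cup b 1) [cross b 0, cross b 2, cross b 1] rfl rfl) <|
  .trans (.step [cup 0, cup 1] (.exchange (.crossing b) (.crossing b) 0 0) [cross b 1] rfl rfl) <|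
  .trans (.step [cup 0] (.slideCup b 1) [cross b 0, cross b 1] rfl rfl) <|
  .trans (.step [] (.exchange .cup .cup 0 0) [cross (!b) 1, cross b 0, cross b 1] rfl rfl) <|
  .trans (.step [cup 0, cup 0] (Rule.passRight b (!b) 0).symm [] rfl rfl) <|
  .trans (.step [cup 0] (.reidemeister₁Cup b 0) [cross b 1, cross (!b) 0] rfl rfl) <|
  .step [cup 0] (.slideCup b 0) [cross (!b) 0] rfl rfl

/-- Doubling a curl at a local maximum gives rise to a full twist. -/
theorem eqv_double_reidemeister₁Cap (b : Bool) :
    Eqv 4 (double [cross b 0, cap 0])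
      ([cross (!b) 0, cross (!b) 0] ++ double [cap 0]) :=
  .trans (.step [cross b 1, cross b 0, cross b 2] (.reidemeister₁Cap b 1) [cap 0] rfl rfl) <|
  .trans (.step [cross b 1, cross b 0] (.slideCap b 1) [cap 0] rfl rfl) <|
  .trans (.step [cross b 1, cross b 0, cross (!b) 1] (Rule.exchange .cap .cap 0 0).symm [] rfl rfl) <|
  .trans (.step [] (Rule.passLeft (!b) b 0).symm [cap 0, cap 0] rfl rfl) <|
  .trans (.step [cross (!b) 0, cross b 1] (.reidemeister₁Cap b 0) [cap 0] rfl rfl) <|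
  .step [cross (!b) 0] (.slideCap b 0) [cap 0] rfl rfl

theorem eqv_double_reidemeister₂ (b : Bool) :
    Eqv 4 (double [cross b 0, cross (!b) 0])
      (double []) :=
  .trans (.step [cross b 1] (.exchange (.crossing b) (.crossing b) 0 0) [cross b 1, cross (!b) 1, cross (!b) 0, cross (!b) 2, cross (!b) 1] rfl rfl) <|
  .trans (.step [cross b 1, cross b 2, cross b 0] (.reidemeister₂ b 1) [cross (!b) 0, cross (!b) 2, cross (!b) 1] rfl rfl) <|
  .trans (.step [cross b 1, cross b 2] (.reidemeister₂ b 0) [cross (!b) 2, cross (!b) 1] rfl rfl) <|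
  .trans (.step [cross b 1] (.reidemeister₂ b 2) [cross (!b) 1] rfl rfl) <|
  .step [] (.reidemeister₂ b 1) [] rfl rfl

/-- The eight crossings are regrouped by exchanges only, so that the two strands of the first band
cross the other four strands one after the other. -/
theorem eqv_double_cross_cross (b : Bool) :
    Eqv 6 (double [cross b 0, cross b 1])
      ([cross b 1, cross b 2, cross b 3, cross b 4] ++
        [cross b 0, cross b 1, cross b 2, cross b 3]) :=
  .trans (.step [cross b 1] (.exchange (.crossing b) (.crossing b) 0 0) [cross b 1, cross b 3, cross b 2, cross b 4, cross b 3] rfl rfl) <|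
  .trans (.step [cross b 1, cross b 2, cross b 0] (.exchange (.crossing b) (.crossing b) 1 0) [cross b 2, cross b 4, cross b 3] rfl rfl) <|
  .trans (.step [cross b 1, cross b 2] (.exchange (.crossing b) (.crossing b) 0 1) [cross b 1, cross b 2, cross b 4, cross b 3] rfl rfl) <|
  .trans (.step [cross b 1, cross b 2, cross b 3, cross b 0, cross b 1] (.exchange (.crossing b) (.crossing b) 2 0) [cross b 3] rfl rfl) <|
  .trans (.step [cross b 1, cross b 2, cross b 3, cross b 0] (.exchange (.crossing b) (.crossing b) 1 1) [cross b 2, cross b 3] rfl rfl) <|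
  .step [cross b 1, cross b 2, cross b 3] (.exchange (.crossing b) (.crossing b) 0 2) [cross b 1, cross b 2, cross b 3] rfl rfl

/-- A single strand passes the four crossings of two bands, by one third Reidemeister move for each.
-/
theorem eqv_pass_double_cross (b : Bool) :
    Eqv 5 ([cross b 0, cross b 1, cross b 2, cross b 3] ++ double [cross b 0])
      (shift 1 (double [cross b 0]) ++ [cross b 0, cross b 1, cross b 2, cross b 3]) :=
  .trans (.step [cross b 0, cross b 1, cross b 2] (Rule.exchange (.crossing b) (.crossing b) 1 0).symm [cross b 0, cross b 2, cross b 1] rfl rfl) <|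
  .trans (.step [cross b 0, cross b 1, cross b 2, cross b 1] (Rule.exchange (.crossing b) (.crossing b) 0 1).symm [cross b 2, cross b 1] rfl rfl) <|
  .trans (.step [cross b 0] (.passRight b b 1) [cross b 0, cross b 3, cross b 2, cross b 1] rfl rfl) <|
  .trans (.step [] (.exchange (.crossing b) (.crossing b) 0 0) [cross b 1, cross b 2, cross b 0, cross b 3, cross b 2, cross b 1] rfl rfl) <|
  .trans (.step [cross b 2, cross b 0, cross b 1] (Rule.exchange (.crossing b) (.crossing b) 0 0).symm [cross b 3, cross b 2, cross b 1] rfl rfl) <|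
  .trans (.step [cross b 2, cross b 0, cross b 1, cross b 0] (.passRight b b 2) [cross b 1] rfl rfl) <|
  .trans (.step [cross b 2] (.passRight b b 0) [cross b 3, cross b 2, cross b 3, cross b 1] rfl rfl) <|
  .trans (.step [cross b 2, cross b 1, cross b 0, cross b 1, cross b 3, cross b 2] (Rule.exchange (.crossing b) (.crossing b) 1 0).symm [] rfl rfl) <|
  .trans (.step [cross b 2, cross b 1, cross b 0] (.exchange (.crossing b) (.crossing b) 1 0) [cross b 2, cross b 1, cross b 3] rfl rfl) <|
  .trans (.step [cross b 2, cross b 1, cross b 0, cross b 3] (.passRight b b 1) [cross b 3] rfl rfl) <|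
  .trans (.step [cross b 2, cross b 1] (.exchange (.crossing b) (.crossing b) 0 1) [cross b 2, cross b 1, cross b 2, cross b 3] rfl rfl) <|
  .step [cross b 2, cross b 1, cross b 3] (.exchange (.crossing b) (.crossing b) 0 0) [cross b 1, cross b 2, cross b 3] rfl rfl

/-- The two strands of the moving band are taken past the doubled crossing separately. -/
theorem eqv_double_reidemeister₃ (b : Bool) :
    Eqv 6 (double [cross b 0, cross b 1, cross b 0])
      (double [cross b 1, cross b 0, cross b 1]) :=
  .trans ((eqv_double_cross_cross b).append (double [cross b 0])) <|
  .trans (.prepend (u := [cross b 1, cross b 2, cross b 3, cross b 4]) (k := 6)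
    (by simp [Fits, Slice.out, Piece.ins, Piece.outs]) ((eqv_pass_double_cross b).widen 1)) <|
  .trans (((eqv_pass_double_cross b).shift 1 0).append [cross b 0, cross b 1, cross b 2, cross b 3]) <|
  .symm (.prepend (u := double [cross b 1]) (k := 6)
    (by simp [double, Slice.double, Fits, Slice.out, Piece.ins, Piece.outs])
    (eqv_double_cross_cross b))


/-! Words beside each other commute -/

/-- The exchange move, iterated over the slices of `w`. The shift of `w` changes because `s` alters
the number of strands to its left. -/
theorem eqv_comm_slice (s : Slice) {w : List Slice} {l n m : ℕ} (hs : s.pos + s.piece.ins ≤ l)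
    (h : Fits n w m) : Eqv (l + n) (s :: shift (s.out l) w) (shift l w ++ [s]) := by
  induction w generalizing n with
  | nil => exact .refl _
  | cons t w ih =>
    obtain ⟨d, rfl⟩ := Nat.exists_eq_add_of_le hs
    have h1 : Fits (s.pos + s.piece.ins + d + n)
        [s, ⟨t.piece, s.out (s.pos + s.piece.ins + d) + t.pos⟩]
        (s.out (s.pos + s.piece.ins + d) + t.out n) := by
      have := h.1
      simp only [Fits, Slice.out]
      omega
    have h2 : Eqv (s.pos + s.piece.ins + d + n)
        [s, ⟨t.piece, s.out (s.pos + s.piece.ins + d) + t.pos⟩]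
        [⟨t.piece, s.pos + s.piece.ins + d + t.pos⟩, s] := by
      have := LocalMove.exchange s.piece t.piece s.pos (d + t.pos)
      refine Eqv.of_localMove (m := s.out (s.pos + s.piece.ins + d) + t.out n) ?_ h1
      have e : s.out (s.pos + s.piece.ins + d) + t.pos = s.pos + s.piece.outs + (d + t.pos) := by
        simp only [Slice.out]; omega
      rw [e, Nat.add_assoc _ d]
      exact this
    refine (h2.append (shift (s.out (s.pos + s.piece.ins + d)) w)).trans ?_
    refine Eqv.prepend (u := [⟨t.piece, s.pos + s.piece.ins + d + t.pos⟩]) ?_ (ih h.2)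
    have := h.1
    simp only [Fits, Slice.out]
    omega

/-- Tangles that lie beside each other can be moved past each other. -/
theorem eqv_comm {u w : List Slice} {l l' n m : ℕ} (hu : Fits l u l') (hw : Fits n w m) :
    Eqv (l + n) (u ++ shift l' w) (shift l w ++ u) := by
  induction u generalizing l with
  | nil =>
    obtain rfl : l = l' := hu
    simpa using Eqv.refl _
  | cons s u ih =>
    refine (Eqv.prepend (u := [s]) (k := s.out l + n) ?_ (ih hu.2)).trans ?_
    · have := hu.1
      simp only [Fits, Slice.out]
      omega
    · simpa using (eqv_comm_slice s hu.1 hw).append u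

/-! Doubling -/

@[simp] theorem double_nil : double [] = [] := rfl

@[simp] theorem double_cons (s : Slice) (w : List Slice) :
    double (s :: w) = s.double ++ double w := rfl

@[simp] theorem double_append (u v : List Slice) : double (u ++ v) = double u ++ double v :=
  List.flatMap_append

theorem Slice.double_add (q : Piece) (p i : ℕ) :
    Slice.double ⟨q, p + i⟩ = shift (2 * p) (Slice.double ⟨q, i⟩) := by
  cases q <;> simp [Slice.double, Nat.mul_add, Nat.add_assoc]

theorem double_shift (p : ℕ) (w : List Slice) : double (shift p w) = shift (2 * p) (double w) := by
  induction w with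
  | nil => rfl
  | cons s w ih => simp [ih, Slice.double_add]

theorem Slice.fits_double (s : Slice) {n : ℕ} (h : s.pos + s.piece.ins ≤ n) :
    Fits (2 * n) s.double (2 * s.out n) := by
  obtain ⟨q, i⟩ := s
  cases q <;> simp only [Slice.double, Fits, Slice.out, Piece.ins, Piece.outs] at * <;> omega

theorem Fits.double {w : List Slice} {n m : ℕ} (h : Fits n w m) :
    Fits (2 * n) (KnotTheory.double w) (2 * m) := by
  induction w generalizing n with
  | nil => obtain rfl : n = m := h; rfl
  | cons s w ih => exact (s.fits_double h.1).append (ih h.2)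

theorem shift_clasp (b : Bool) (p q : ℕ) : shift p (clasp b q) = clasp b (p + q) := rfl

theorem shift_twists (n : ℤ) (p q : ℕ) : shift p (twists n q) = twists n (p + q) := by
  simp [twists, shift]

theorem fits_clasp (b : Bool) : Fits 2 (clasp b 0) 2 := by
  simp [clasp, Fits, Slice.out, Piece.ins, Piece.outs]

theorem fits_replicate (b : Bool) (k : ℕ) : Fits 2 (List.replicate k (cross b 0)) 2 := by
  induction k with
  | zero => rfl
  | succ k ih => exact ⟨by simp [Piece.ins], ih⟩

/-! Tangles sliding along a doubled diagram -/

/-- The tangle `T` with two ends at the bottom and two at the top can be moved past other strands,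
and becomes the tangle `T'` when it is moved over a local maximum or minimum of the two strands. -/
structure Slides (T T' : List Slice) : Prop where
  fits : Fits 2 T 2
  fits' : Fits 2 T' 2
  right : ∀ c, Eqv 3 (shift 1 T ++ [cross c 0, cross c 1]) ([cross c 0, cross c 1] ++ T)
  left : ∀ c, Eqv 3 (T ++ [cross c 1, cross c 0]) ([cross c 1, cross c 0] ++ shift 1 T)
  overCup : Eqv 0 ([cup 0, cup 1] ++ T) ([cup 0, cup 1] ++ shift 2 T')
  overCap : Eqv 4 (T ++ [cap 1, cap 0]) (shift 2 T' ++ [cap 1, cap 0])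

namespace Slides

theorem nil : Slides [] [] :=
  ⟨rfl, rfl, fun _ => .refl _, fun _ => .refl _, .refl _, .refl _⟩

/-- Sliding over an extremum turns a tangle upside down, so the order of the factors is reversed.
While only one factor has passed, the two lie beside each other and `eqv_comm` applies. -/
theorem append {S S' T T' : List Slice} (hS : Slides S S') (hT : Slides T T') :
    Slides (S ++ T) (T' ++ S') where
  fits := hS.fits.append hT.fits
  fits' := hT.fits'.append hS.fits'
  right c := by
    have h1 := (hT.right c).prepend (u := shift 1 S) (hS.fits.shift 1 0)
    have h2 := (hS.right c).append T
    simpa using h1.trans (by simpa using h2)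
  left c := by
    have h1 := (hT.left c).prepend (u := S) (hS.fits.widen 1)
    have h2 := (hS.left c).append (shift 1 T)
    simpa using h1.trans (by simpa using h2)
  overCup := by
    have hc : Fits 0 [cup 0, cup 1] 4 := by
      simp [Fits, Slice.out, Piece.ins, Piece.outs]
    have h1 := hS.overCup.append T
    have h2 := (eqv_comm hT.fits hS.fits').symm.prepend hc
    have h3 := hT.overCup.append (shift 2 S')
    simp only [List.append_assoc, shift_append] at *
    exact h1.trans (h2.trans h3)
  overCap := by
    have h1 := hT.overCap.prepend (hS.fits.widen 2)
    have h2 := (eqv_comm hS.fits hT.fits').append [cap 1, cap 0]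
    have h3 := hS.overCap.prepend (hT.fits'.shift 2 0)
    simp only [List.append_assoc, shift_append] at *
    exact h1.trans (h2.trans h3)

/-- Used to restore the order of clasp and twists after `append` has reversed it. -/
theorem congr {T T' T'' : List Slice} (h : Slides T T') (h' : Eqv 2 T' T'') : Slides T T'' where
  fits := h.fits
  fits' := h'.fits_iff.1 h.fits'
  right := h.right
  left := h.left
  overCup := h.overCup.trans ((h'.shift 2 0).prepend (by simp [Fits, Slice.out, Piece.ins, Piece.outs]))
  overCap := h.overCap.trans ((h'.shift 2 0).append _)

end Slides

theorem slides_cross (b : Bool) : Slides [cross b 0] [cross b 0] where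
  fits := fits_replicate b 1
  fits' := fits_replicate b 1
  right c := .step [] (Rule.passRight c b 0).symm [] rfl rfl
  left c := .step [] (.passLeft b c 0) [] rfl rfl
  overCup := eqv_cup_cross b
  overCap := eqv_cap_cross b

theorem slides_replicate (b : Bool) (k : ℕ) :
    Slides (List.replicate k (cross b 0)) (List.replicate k (cross b 0)) := by
  induction k with
  | zero => exact .nil
  | succ k ih =>
    have := ih.append (slides_cross b)
    rwa [← List.replicate_succ', List.singleton_append, ← List.replicate_succ] at this

/-- The clasp is symmetric under a half turn in the plane. A strand passes it on either side, but
the sequences of moves differ according to the signs of the crossings. -/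
theorem slides_clasp (b : Bool) : Slides (clasp b 0) (clasp b 0) where
  fits := fits_clasp b
  fits' := fits_clasp b
  right c := by
    obtain rfl | rfl : b = c ∨ b = !c := by cases b <;> cases c <;> simp
    · exact eqv_clasp_right_same b
    · exact eqv_clasp_right_opposite c
  left c := by
    obtain rfl | rfl : b = c ∨ b = !c := by cases b <;> cases c <;> simp
    · exact eqv_clasp_left_same b
    · exact eqv_clasp_left_opposite c
  overCup := eqv_cup_clasp b
  overCap := eqv_cap_clasp b

theorem eqv_replicate_comm {s : Slice} {T : List Slice} (hs : Fits 2 [s] 2)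
    (h : Eqv 2 ([s] ++ T) (T ++ [s])) (k : ℕ) :
    Eqv 2 (List.replicate k s ++ T) (T ++ List.replicate k s) := by
  induction k with
  | zero => simpa using Eqv.refl _
  | succ k ih =>
    have h1 := ih.prepend hs
    have h2 := h.append (List.replicate k s)
    simpa [List.replicate_succ] using h1.trans (by simpa using h2)

theorem eqv_replicate_clasp (b c : Bool) (k : ℕ) :
    Eqv 2 (List.replicate k (cross c 0) ++ clasp b 0)
      (clasp b 0 ++ List.replicate k (cross c 0)) := by
  refine eqv_replicate_comm (fits_replicate c 1) ?_ k
  obtain rfl | rfl : b = c ∨ b = !c := by cases b <;> cases c <;> simp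
  · exact eqv_cross_clasp_same b
  · exact eqv_cross_clasp_opposite c

theorem eqv_replicate_replicate (b c : Bool) (k l : ℕ) :
    Eqv 2 (List.replicate k (cross b 0) ++ List.replicate l (cross c 0))
      (List.replicate l (cross c 0) ++ List.replicate k (cross b 0)) := by
  refine eqv_replicate_comm (fits_replicate b 1) ?_ k
  refine (eqv_replicate_comm (fits_replicate c 1) ?_ l).symm
  obtain rfl | rfl : b = c ∨ b = !c := by cases b <;> cases c <;> simp
  · rfl
  -- Half twists of opposite signs commute because both products cancel to the trivial word.
  · exact .trans (.step [] (.reidemeister₂ c 0) [] rfl rfl)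
      (.step [] (Rule.reidemeister₂' c 0).symm [] rfl rfl)

theorem twists_natCast (k p : ℕ) : twists k p = List.replicate (2 * k) (cross true p) := by
  rcases k with _ | k
  · rfl
  · simp only [twists, Int.natAbs_natCast]
    simp

theorem twists_neg_natCast (k p : ℕ) :
    twists (-k) p = List.replicate (2 * k) (cross false p) := by
  simp [twists]

/-- Full twists of opposite directions cancel; this is the case of `eqv_twists_left` in which the
number of crossings drops. -/
theorem eqv_cancel_replicate (b : Bool) (k : ℕ) :
    Eqv 2 ([cross (!b) 0, cross (!b) 0] ++ List.replicate (2 * (k + 1)) (cross b 0))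
      (List.replicate (2 * k) (cross b 0)) :=
  .trans (.step [cross (!b) 0] (.reidemeister₂' b 0)
      (List.replicate (2 * k + 1) (cross b 0)) rfl rfl)
    (.step [] (.reidemeister₂' b 0) (List.replicate (2 * k) (cross b 0)) rfl rfl)

/-- An additional full twist. -/
theorem eqv_twists_left (b : Bool) (n : ℤ) :
    Eqv 2 ([cross b 0, cross b 0] ++ twists n 0) (twists (n + if b then 1 else -1) 0) := by
  obtain ⟨k, rfl | rfl⟩ := n.eq_nat_or_neg <;> cases b <;> simp only [if_true, Bool.false_eq_true,
    if_false]
  · rcases k with _ | k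
    · exact .refl _
    · have : ((k + 1 : ℕ) : ℤ) + -1 = (k : ℕ) := by push_cast; ring
      rw [this, twists_natCast, twists_natCast]
      exact eqv_cancel_replicate true k
  · have : (k : ℤ) + 1 = (k + 1 : ℕ) := by push_cast; ring
    rw [this, twists_natCast, twists_natCast]
    exact .refl _
  · have : -(k : ℤ) + -1 = -(k + 1 : ℕ) := by push_cast; ring
    rw [this, twists_neg_natCast, twists_neg_natCast]
    exact .refl _
  · rcases k with _ | k
    · exact .refl _
    · have : -((k + 1 : ℕ) : ℤ) + 1 = -(k : ℕ) := by push_cast; ring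
      rw [this, twists_neg_natCast, twists_neg_natCast]
      exact eqv_cancel_replicate false k

theorem eqv_twists_right (b : Bool) (n : ℤ) :
    Eqv 2 (twists n 0 ++ [cross b 0, cross b 0]) (twists (n + if b then 1 else -1) 0) :=
  (eqv_replicate_replicate _ b _ 2).trans (eqv_twists_left b n)

/-- The tangle that is inserted into a doubled diagram. -/
def bead (b : Bool) (n : ℤ) : List Slice := clasp b 0 ++ twists n 0

theorem shift_bead (b : Bool) (n : ℤ) (p : ℕ) :
    shift p (bead b n) = clasp b p ++ twists n p := by
  simp [bead, shift_clasp, shift_twists]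

/-- An extremum exchanges clasp and twists, and these commute, so the bead comes out unchanged. -/
theorem slides_bead (b : Bool) (n : ℤ) : Slides (bead b n) (bead b n) :=
  ((slides_clasp b).append (slides_replicate _ _)).congr (eqv_replicate_clasp _ _ _)

namespace Slides
variable {T : List Slice}

/-- A tangle on two parallel strands passes over or under two other parallel strands. -/
theorem double_cross_left (h : Slides T T) (c : Bool) :
    Eqv 4 (T ++ double [cross c 0]) (double [cross c 0] ++ shift 2 T) := by
  have h1 := ((h.left c).widen 1).append [cross c 2, cross c 1]
  have h2 := ((h.left c).shift 1 0).prepend (u := [cross c 1, cross c 0])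
    (n := 4) (by simp [Fits, Slice.out, Piece.ins, Piece.outs])
  simp only [List.append_assoc, shift_append, shift_shift] at *
  exact h1.trans h2

theorem double_cross_right (h : Slides T T) (c : Bool) :
    Eqv 4 (shift 2 T ++ double [cross c 0]) (double [cross c 0] ++ T) := by
  -- The middle crossings are exchanged so that the tangle, coming from the right, meets the two
  -- strands of the other band one at a time.
  have h0 : Eqv 4 (double [cross c 0])
      ([cross c 1, cross c 2] ++
        [cross c 0, cross c 1]) :=
    .step [cross c 1] (.exchange (.crossing c) (.crossing c) 0 0)
      [cross c 1] rfl rfl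
  have h1 := ((h.right c).shift 1 0).append [cross c 0, cross c 1]
  have h2 := ((h.right c).widen 1).prepend (u := [cross c 1, cross c 2])
    (n := 4) (by simp [Fits, Slice.out, Piece.ins, Piece.outs])
  have h3 := h0.prepend (h.fits.shift 2 0)
  have h4 := h0.append T
  simp only [List.append_assoc, shift_append, shift_shift] at *
  exact h3.trans (h1.trans (h2.trans h4.symm))

end Slides

/-- The full twist below the bead is moved through the clasp and then merged with the twists. -/
theorem eqv_bead_left (b c : Bool) (n : ℤ) :
    Eqv 2 ([cross c 0, cross c 0] ++ bead b n) (bead b (n + if c then 1 else -1)) := by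
  have h1 := (eqv_replicate_clasp b c 2).append (twists n 0)
  have h2 := (eqv_twists_left c n).prepend (fits_clasp b)
  simp only [List.append_assoc] at h1
  exact h1.trans h2

theorem eqv_bead_right (b c : Bool) (n : ℤ) :
    Eqv 2 (bead b n ++ [cross c 0, cross c 0]) (bead b (n + if c then 1 else -1)) := by
  have h2 := (eqv_twists_right c n).prepend (fits_clasp b)
  rwa [← List.append_assoc] at h2

/-- The word that arises by doubling the strands of `u ++ v` and inserting `T` between the two
words, in the two strands replacing the strand at position `j`. -/
def insertDouble (u v : List Slice) (j : ℕ) (T : List Slice) : List Slice :=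
  double u ++ shift (2 * j) T ++ double v


/-! ### Widths, and the two parts of a diagram cut at a height -/

theorem Fits.foldl_out {w : List Slice} {n m : ℕ} (h : Fits n w m) :
    w.foldl (fun n s => s.out n) n = m := by
  induction w generalizing n with
  | nil => exact h
  | cons s w ih => exact ih h.2

theorem width_append {u v : List Slice} {m : ℕ} (h : Fits 0 u m) :
    width (u ++ v) u.length = m := by
  rw [width, List.take_left']
  · exact h.foldl_out
  · rfl

theorem LinkDiagram.fits_take (D : LinkDiagram) (k : ℕ) :
    Fits 0 (D.word.take k) (width D.word k) := by
  have h := D.closed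
  rw [← List.take_append_drop k D.word, fits_append] at h
  obtain ⟨m, hm, -⟩ := h
  rw [width, hm.foldl_out]
  exact hm

theorem LinkDiagram.fits_drop (D : LinkDiagram) (k : ℕ) :
    Fits (width D.word k) (D.word.drop k) 0 := by
  have h := D.closed
  rw [← List.take_append_drop k D.word, fits_append] at h
  obtain ⟨m, hm, hv⟩ := h
  rw [width, hm.foldl_out]
  exact hv

/-! Moving a tangle along a doubled diagram -/

section
variable {T : List Slice}

/-- The tangle and the doubled slice lie beside each other, so this is only a change of heights. -/
theorem Slides.eqv_left (h : Slides T T) {s : Slice} {n j : ℕ} (hs : s.pos + s.piece.ins ≤ n)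
    (hj : j < s.pos) :
    Eqv (2 * n) (shift (2 * j) T ++ s.double) (s.double ++ shift (2 * j) T) := by
  obtain ⟨q, i⟩ := s
  obtain ⟨d, rfl⟩ : ∃ d, i = (j + 1) + d := Nat.exists_eq_add_of_le hj
  obtain ⟨n', rfl⟩ : ∃ n', n = (j + 1) + n' := Nat.exists_eq_add_of_le (by simp only at hs; omega)
  rw [Slice.double_add]
  have h1 : Fits (2 * (j + 1)) (shift (2 * j) T) (2 * (j + 1)) := h.fits.shift (2 * j) 0
  have h2 := Slice.fits_double ⟨q, d⟩ (n := n') (by simp only at hs ⊢; omega)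
  rw [Nat.mul_add 2 (j + 1) n']
  exact eqv_comm h1 h2

theorem Slides.eqv_right (h : Slides T T) {s : Slice} {n j : ℕ} (hj : s.pos + s.piece.ins + j < n) :
    Eqv (2 * n) (shift (2 * (s.pos + s.piece.ins + j)) T ++ s.double)
      (s.double ++ shift (2 * (s.pos + s.piece.outs + j)) T) := by
  obtain ⟨r, rfl⟩ : ∃ r, n = (s.pos + s.piece.ins + j + 1) + r := Nat.exists_eq_add_of_le hj
  have h1 := s.fits_double (n := s.pos + s.piece.ins) le_rfl
  have h2 := h.fits.shift (2 * j) (2 * r)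
  have h3 := (eqv_comm h1 h2).symm
  have e : s.out (s.pos + s.piece.ins) = s.pos + s.piece.outs := by simp only [Slice.out]; omega
  rw [shift_shift, shift_shift, e, ← Nat.mul_add, ← Nat.mul_add] at h3
  rwa [show 2 * (s.pos + s.piece.ins + j + 1 + r) =
    2 * (s.pos + s.piece.ins) + (2 * j + 2 + 2 * r) by ring]

theorem Slides.eqv_cup (h : Slides T T) {n i : ℕ} (hi : i ≤ n) :
    Eqv (2 * n) ((cup i).double ++ shift (2 * i) T) ((cup i).double ++ shift (2 * (i + 1)) T) := by
  obtain ⟨r, rfl⟩ := Nat.exists_eq_add_of_le hi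
  have := h.overCup.shift (2 * i) (2 * r)
  simp only [shift_append, shift_shift] at this
  rw [Nat.mul_add]
  exact this

theorem Slides.eqv_cap (h : Slides T T) {n i : ℕ} (hi : i + 2 ≤ n) :
    Eqv (2 * n) (shift (2 * i) T ++ (cap i).double) (shift (2 * (i + 1)) T ++ (cap i).double) := by
  obtain ⟨r, rfl⟩ := Nat.exists_eq_add_of_le hi
  have := h.overCap.shift (2 * i) (2 * r)
  simp only [shift_append, shift_shift] at this
  rw [Nat.mul_add, Nat.mul_add]
  exact this

theorem Slides.eqv_cross_right (h : Slides T T) {b : Bool} {n i : ℕ} (hi : i + 2 ≤ n) :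
    Eqv (2 * n) (shift (2 * i) T ++ (cross b i).double)
      ((cross b i).double ++ shift (2 * (i + 1)) T) := by
  obtain ⟨r, rfl⟩ := Nat.exists_eq_add_of_le hi
  have := (h.double_cross_left b).shift (2 * i) (2 * r)
  simp only [shift_append, shift_shift] at this
  rw [Nat.mul_add, Nat.mul_add]
  exact this

theorem Slides.eqv_cross_left (h : Slides T T) {b : Bool} {n i : ℕ} (hi : i + 2 ≤ n) :
    Eqv (2 * n) (shift (2 * (i + 1)) T ++ (cross b i).double)
      ((cross b i).double ++ shift (2 * i) T) := by
  obtain ⟨r, rfl⟩ := Nat.exists_eq_add_of_le hi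
  have := (h.double_cross_right b).shift (2 * i) (2 * r)
  simp only [shift_append, shift_shift] at this
  rw [Nat.mul_add, Nat.mul_add]
  exact this

end

/-- `T` inserted into the doubled word `w` at the point `p`. -/
def insertAt (w : List Slice) (T : List Slice) (p : ℕ × ℕ) : List Slice :=
  insertDouble (w.take p.1) (w.drop p.1) p.2 T

theorem eq_take_append_of_getElem? {w : List Slice} {k : ℕ} {s : Slice} (h : w[k]? = some s) :
    w.take (k + 1) = w.take k ++ [s] ∧ w.drop k = s :: w.drop (k + 1) := by
  obtain ⟨hk, rfl⟩ := List.getElem?_eq_some_iff.1 h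
  exact ⟨(List.take_append_getElem hk).symm, List.drop_eq_getElem_cons hk⟩

theorem LinkDiagram.fits_slice (D : LinkDiagram) {k : ℕ} {s : Slice} (h : D.word[k]? = some s) :
    s.pos + s.piece.ins ≤ width D.word k ∧ width D.word (k + 1) = s.out (width D.word k) := by
  obtain ⟨h1, h2⟩ := eq_take_append_of_getElem? h
  have h3 := D.fits_drop k
  rw [h2] at h3
  refine ⟨h3.1, ?_⟩
  rw [width, h1, List.foldl_append]
  rfl

theorem insertAt_eqv_up {D : LinkDiagram} {T : List Slice} {k j j' : ℕ} {s : Slice}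
    (hs : D.word[k]? = some s)
    (h : Eqv (2 * width D.word k) (shift (2 * j) T ++ s.double) (s.double ++ shift (2 * j') T)) :
    Eqv 0 (insertAt D.word T (k, j)) (insertAt D.word T (k + 1, j')) := by
  obtain ⟨h1, h2⟩ := eq_take_append_of_getElem? hs
  have := h.ctx (D.fits_take k).double (double (D.word.drop (k + 1)))
  simpa [insertAt, insertDouble, h1, h2] using this

/-- The places of a doubled diagram in which a tangle can be inserted are equivalent along a
component. -/
theorem Slides.insertAt_eqv {T : List Slice} (h : Slides T T) (D : LinkDiagram) (p q : D.Point)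
    (hpq : Passes D.word p.1 q.1 ∨ Turns D.word p.1 q.1 ∨ Crosses D.word p.1 q.1) :
    Eqv 0 (insertAt D.word T p.1) (insertAt D.word T q.1) := by
  obtain ⟨p, hp⟩ := p
  obtain ⟨q, hq⟩ := q
  simp only at hpq
  rcases hpq with hpq | hpq | hpq
  · cases hpq with
    | left hs hj => exact insertAt_eqv_up hs (h.eqv_left (D.fits_slice hs).1 hj)
    | right hs => exact insertAt_eqv_up hs (h.eqv_right hp)
  · cases hpq with
    | @cup k i hs =>
      obtain ⟨h1, h2⟩ := eq_take_append_of_getElem? hs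
      have := (h.eqv_cup (i := i) (D.fits_slice hs).1).ctx (D.fits_take k).double
        (double (D.word.drop (k + 1)))
      simpa [insertAt, insertDouble, h1, h2] using this
    | @cap k i hs =>
      obtain ⟨h1, h2⟩ := eq_take_append_of_getElem? hs
      have := (h.eqv_cap (i := i) (D.fits_slice hs).1).ctx (D.fits_take k).double
        (double (D.word.drop (k + 1)))
      simpa [insertAt, insertDouble, h1, h2] using this
  · cases hpq with
    | right hs => exact insertAt_eqv_up hs (h.eqv_cross_right (D.fits_slice hs).1)
    | left hs => exact insertAt_eqv_up hs (h.eqv_cross_left (D.fits_slice hs).1)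

/-- All points of the diagram lie on the same component. -/
def LinkDiagram.Connected (D : LinkDiagram) : Prop :=
  Subsingleton (Quot fun p q : D.Point =>
    Passes D.word p.1 q.1 ∨ Turns D.word p.1 q.1 ∨ Crosses D.word p.1 q.1)

/-- Any two points of a knot diagram are joined by a chain of elementary arcs, along which the
tangle is slid. -/
theorem Slides.insertAt_eqv_of_connected {T : List Slice} (h : Slides T T) {D : LinkDiagram}
    (hD : D.Connected) (p q : D.Point) :
    Eqv 0 (insertAt D.word T p.1) (insertAt D.word T q.1) := by
  have hpq := Quot.eqvGen_exact (hD.elim (Quot.mk _ p) (Quot.mk _ q))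
  induction hpq with
  | rel p q hpq => exact h.insertAt_eqv D p q hpq
  | refl p => exact .refl _
  | symm p q _ ih => exact ih.symm
  | trans p q r _ _ ih ih' => exact ih.trans ih'

/-! Moves of the doubled diagram -/

theorem eqv_double_of_base {n m k : ℕ} {a b : List Slice} (i : ℕ)
    (h : Eqv (2 * n) (double a) (double b)) (hk : Fits k (shift i a) m) (hn : i + n ≤ k) :
    Eqv (2 * k) (double (shift i a)) (double (shift i b)) := by
  obtain ⟨r, rfl⟩ := Nat.exists_eq_add_of_le hn
  rw [double_shift, double_shift, Nat.mul_add, Nat.mul_add]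
  exact h.shift _ _

theorem eqv_double_exchange (a b : Piece) (i d : ℕ) {n : ℕ}
    (h : i + a.ins + d + b.ins ≤ n) :
    Eqv (2 * n) (double [⟨a, i⟩, ⟨b, i + a.outs + d⟩]) (double [⟨b, i + a.ins + d⟩, ⟨a, i⟩]) := by
  obtain ⟨r, rfl⟩ : ∃ r, n = (i + a.ins) + r := Nat.exists_eq_add_of_le (by omega)
  have h1 := Slice.fits_double ⟨a, i⟩ (n := i + a.ins) le_rfl
  have h2 := Slice.fits_double ⟨b, d⟩ (n := r) (by simp only; omega)
  have e : Slice.out ⟨a, i⟩ (i + a.ins) = i + a.outs := by simp only [Slice.out]; omega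
  rw [e] at h1
  simp only [double_cons, double_nil, List.append_nil]
  rw [Slice.double_add b (i + a.outs), Slice.double_add b (i + a.ins), Nat.mul_add]
  exact eqv_comm h1 h2

/-- Blackboard doubling respects all moves that keep the blackboard framing; the exceptions are the
first Reidemeister moves. -/
theorem eqv_double_of_localMove {a b : List Slice} (h : LocalMove a b) {n m : ℕ}
    (ha : Fits n a m) :
    Eqv (2 * n) (double a) (double b) ∨
      (∃ c i, a = [cup i, cross c i] ∧ b = [cup i]) ∨
      ∃ c i, a = [cross c i, cap i] ∧ b = [cap i] := by
  cases h with
  | exchange a b i d =>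
    left
    refine eqv_double_exchange a b i d ?_
    simp only [Fits, Slice.out] at ha
    omega
  | zigzag i =>
    exact .inl (eqv_double_of_base (n := 1) i eqv_double_zigzag ha
      (by simp [Fits, Slice.out, Piece.ins, Piece.outs] at ha; omega))
  | zagzig i =>
    exact .inl (eqv_double_of_base (n := 1) i eqv_double_zagzig ha
      (by simp [Fits, Slice.out, Piece.ins, Piece.outs] at ha; omega))
  | slideCup b i =>
    exact .inl (eqv_double_of_base (n := 1) i (eqv_double_slideCup b) ha
      (by simp [Fits, Slice.out, Piece.ins, Piece.outs] at ha; omega))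
  | slideCap b i =>
    exact .inl (eqv_double_of_base (n := 3) i (eqv_double_slideCap b) ha
      (by simp [Fits, Slice.out, Piece.ins, Piece.outs] at ha; omega))
  | reidemeister₁Cup b i => exact .inr (.inl ⟨b, i, rfl, rfl⟩)
  | reidemeister₁Cap b i => exact .inr (.inr ⟨b, i, rfl, rfl⟩)
  | reidemeister₂ b i =>
    exact .inl (eqv_double_of_base (n := 2) i (eqv_double_reidemeister₂ b) ha
      (by simp [Fits, Slice.out, Piece.ins, Piece.outs] at ha; omega))
  | reidemeister₃ b i =>
    exact .inl (eqv_double_of_base (n := 3) i (eqv_double_reidemeister₃ b) ha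
      (by simp [Fits, Slice.out, Piece.ins, Piece.outs] at ha; omega))

theorem eqv_double_curl_cup (c d : Bool) (n : ℤ) {k i : ℕ} (h : i ≤ k) :
    Eqv (2 * k) (double [cup i, cross c i] ++ shift (2 * i) (bead d n))
      (double [cup i] ++ shift (2 * i) (bead d (n + if !c then 1 else -1))) := by
  obtain ⟨r, rfl⟩ := Nat.exists_eq_add_of_le h
  have h1 := (eqv_double_reidemeister₁Cup c).append (bead d n)
  have h2 := ((eqv_bead_left d (!c) n).widen 2).prepend (n := 0) (u := double [cup 0])
    (by simp [double, Slice.double, Fits, Slice.out, Piece.ins, Piece.outs])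
  rw [List.append_assoc] at h1
  have h3 := (h1.trans h2).shift (2 * i) (2 * r)
  rw [shift_append, shift_append, ← double_shift, ← double_shift] at h3
  rw [Nat.mul_add]
  exact h3

theorem eqv_double_curl_cap (c d : Bool) (n : ℤ) {k i : ℕ} (h : i + 2 ≤ k) :
    Eqv (2 * k) (shift (2 * i) (bead d n) ++ double [cross c i, cap i])
      (shift (2 * i) (bead d (n + if !c then 1 else -1)) ++ double [cap i]) := by
  obtain ⟨r, rfl⟩ := Nat.exists_eq_add_of_le h
  have h1 := (eqv_double_reidemeister₁Cap c).prepend ((slides_bead d n).fits.widen 2)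
  have h2 := ((eqv_bead_right d (!c) n).widen 2).append (double [cap 0])
  rw [← List.append_assoc] at h1
  have h3 := (h1.trans h2).shift (2 * i) (2 * r)
  rw [shift_append, shift_append, ← double_shift, ← double_shift] at h3
  rw [Nat.mul_add, Nat.mul_add]
  exact h3

/-- Guarantees a strand at the bottom or the top of the moved part, where a bead can sit without
taking part in the move. -/
theorem LocalMove.pos_of_fits {a b : List Slice} (h : LocalMove a b) {n m : ℕ} (ha : Fits n a m) :
    0 < n ∨ 0 < m := by
  cases h with
  | exchange a b i d =>
    cases a <;> cases b <;> simp [Fits, Slice.out, Piece.ins, Piece.outs] at ha <;> omega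
  | _ => simp [Fits, Slice.out, Piece.ins, Piece.outs] at ha; omega

theorem insertAt_append (u v T : List Slice) (j : ℕ) :
    insertAt (u ++ v) T (u.length, j) = insertDouble u v j T := by
  simp [insertAt]

/-- A move of a diagram gives rise to an isotopy of its Whitehead doubles, which changes the number
of twists by a constant. -/
theorem LinkDiagram.Move.exists_eqv {D E : LinkDiagram} (h : D.Move E) :
    ∃ e : ℤ, ∀ c n, ∃ (p : D.Point) (q : E.Point),
      Eqv 0 (insertAt D.word (bead c n) p.1) (insertAt E.word (bead c (n + e)) q.1) := by
  obtain ⟨u, v, a, b, hab, hD, hE⟩ := h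
  have hf := D.closed
  rw [hD, List.append_assoc, fits_append] at hf
  obtain ⟨k, hu, hf⟩ := hf
  obtain ⟨m, ha, hv⟩ := fits_append.1 hf
  have hb := hab.fits ha
  have w1 : width D.word u.length = k := by rw [hD, List.append_assoc, width_append hu]
  have w2 : width E.word u.length = k := by rw [hE, List.append_assoc, width_append hu]
  have w3 : width D.word (u ++ a).length = m := by rw [hD, width_append (hu.append ha)]
  have w4 : width E.word (u ++ b).length = m := by rw [hE, width_append (hu.append hb)]
  rcases eqv_double_of_localMove hab ha with h | ⟨c, i, rfl, rfl⟩ | ⟨c, i, rfl, rfl⟩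
  · refine ⟨0, fun c n => ?_⟩
    rw [add_zero]
    -- The bead is put on the leftmost strand just below the moved part, or just above it if there
    -- is no strand below.
    rcases hab.pos_of_fits ha with hk | hm
    · refine ⟨⟨(u.length, 0), by rwa [w1]⟩, ⟨(u.length, 0), by rwa [w2]⟩, ?_⟩
      simp only [hD, hE]
      rw [List.append_assoc, List.append_assoc, insertAt_append, insertAt_append]
      obtain ⟨r, rfl⟩ := Nat.exists_eq_add_of_lt hk
      have e : 0 + (2 + 2 * r) + 0 = 2 * (0 + r + 1) := by ring
      have h1 := ((slides_bead c n).fits.widen (2 * r)).shift 0 0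
      rw [e] at h1
      simp only [insertDouble, double_append, ← List.append_assoc]
      exact Eqv.ctx (hu.double.append h1) h _
    · refine ⟨⟨((u ++ a).length, 0), by rwa [w3]⟩, ⟨((u ++ b).length, 0), by rwa [w4]⟩, ?_⟩
      simp only [hD, hE]
      rw [insertAt_append, insertAt_append]
      simp only [insertDouble, double_append, List.append_assoc]
      exact Eqv.prepend hu.double (h.append _)
  -- The bead sits directly above the curl and absorbs the full twist that the doubled curl becomes;
  -- that twist consists of crossings of type `!c`.
  · refine ⟨if !c then 1 else -1, fun d n => ?_⟩
    have hi : i ≤ k := hb.1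
    have hm : m = k + 2 := hb.2.symm
    refine ⟨⟨((u ++ [cup i, cross c i]).length, i), by rw [w3]; omega⟩,
      ⟨((u ++ [cup i]).length, i), by rw [w4]; omega⟩, ?_⟩
    simp only [hD, hE]
    rw [insertAt_append, insertAt_append]
    have h1 := (eqv_double_curl_cup c d n hi).ctx hu.double (double v)
    simpa only [insertDouble, double_append, List.append_assoc] using h1
  · refine ⟨if !c then 1 else -1, fun d n => ?_⟩
    have hi : i + 2 ≤ k := hb.1
    refine ⟨⟨(u.length, i), by rw [w1]; omega⟩, ⟨(u.length, i), by rw [w2]; omega⟩, ?_⟩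
    simp only [hD, hE]
    rw [List.append_assoc, List.append_assoc, insertAt_append, insertAt_append]
    have h1 := (eqv_double_curl_cap c d n hi).ctx hu.double (double v)
    simpa only [insertDouble, double_append, List.append_assoc] using h1


/-! Labellings of the points of a diagram, level by level -/

section
variable {α : Type*}

/-- The labels `x` of the strands below a slice and the labels `y` of the strands above it agree on
the vertical strands, and are related by `P` at the piece. -/
def StepLabels (P : Piece → List α → List α → Prop) (s : Slice) (x y : List α) : Prop :=
  ∃ l r a b, l.length = s.pos ∧ P s.piece a b ∧ x = l ++ a ++ r ∧ y = l ++ b ++ r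

/-- `t` lists the labels of the strands below each of the slices of a word, `x` being the labels at
the bottom and `y` the labels at the top. -/
def Labels (P : Piece → List α → List α → Prop) :
    List Slice → List α → List (List α) → List α → Prop
  | [], x, t, y => t = [] ∧ x = y
  | s :: w, x, t, y => ∃ x' t', t = x :: t' ∧ StepLabels P s x x' ∧ Labels P w x' t' y

variable {P : Piece → List α → List α → Prop}

theorem stepLabels_zero {q : Piece} {x y : List α} :
    StepLabels P ⟨q, 0⟩ x y ↔ ∃ a b r, P q a b ∧ x = a ++ r ∧ y = b ++ r := by
  constructor
  · rintro ⟨l, r, a, b, hl, h, rfl, rfl⟩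
    obtain rfl := List.length_eq_zero_iff.1 hl
    exact ⟨a, b, r, h, rfl, rfl⟩
  · rintro ⟨a, b, r, h, rfl, rfl⟩
    exact ⟨[], r, a, b, rfl, h, rfl, rfl⟩

theorem stepLabels_add {q : Piece} {i j : ℕ} {x y : List α} :
    StepLabels P ⟨q, i + j⟩ x y ↔
      ∃ l x' y', l.length = i ∧ x = l ++ x' ∧ y = l ++ y' ∧ StepLabels P ⟨q, j⟩ x' y' := by
  constructor
  · rintro ⟨l, r, a, b, hl, h, rfl, rfl⟩
    refine ⟨l.take i, l.drop i ++ a ++ r, l.drop i ++ b ++ r, ?_, ?_, ?_, l.drop i, r, a, b, ?_, h,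
      rfl, rfl⟩
    · simp only at hl; simp [hl]
    · simp [← List.append_assoc]
    · simp [← List.append_assoc]
    · simp only at hl; simp [hl]
  · rintro ⟨l, x', y', hl, rfl, rfl, l', r, a, b, hl', h, rfl, rfl⟩
    exact ⟨l ++ l', r, a, b, by simp [hl, hl'], h, by simp, by simp⟩

theorem stepLabels_one {q : Piece} {x y : List α} :
    StepLabels P ⟨q, 1⟩ x y ↔
      ∃ c a b r, P q a b ∧ x = c :: (a ++ r) ∧ y = c :: (b ++ r) := by
  rw [show (1 : ℕ) = 1 + 0 from rfl, stepLabels_add]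
  constructor
  · rintro ⟨l, x', y', hl, rfl, rfl, h⟩
    obtain ⟨c, rfl⟩ := List.length_eq_one_iff.1 hl
    obtain ⟨a, b, r, hP, rfl, rfl⟩ := stepLabels_zero.1 h
    exact ⟨c, a, b, r, hP, rfl, rfl⟩
  · rintro ⟨c, a, b, r, h, rfl, rfl⟩
    exact ⟨[c], _, _, rfl, rfl, rfl, stepLabels_zero.2 ⟨a, b, r, h, rfl, rfl⟩⟩

theorem labels_append {u v : List Slice} {x z : List α} {t : List (List α)} :
    Labels P (u ++ v) x t z ↔ ∃ y t₁ t₂, t = t₁ ++ t₂ ∧ Labels P u x t₁ y ∧ Labels P v y t₂ z := by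
  induction u generalizing x t with
  | nil => simp [Labels]
  | cons s u ih =>
    simp only [List.cons_append, Labels, ih]
    constructor
    · rintro ⟨x', t', rfl, h, y, t₁, t₂, rfl, h₁, h₂⟩
      exact ⟨y, x :: t₁, t₂, rfl, ⟨x', t₁, rfl, h, h₁⟩, h₂⟩
    · rintro ⟨y, t₁, t₂, rfl, ⟨x', t₁, rfl, h, h₁⟩, h₂⟩
      exact ⟨x', t₁ ++ t₂, rfl, h, y, t₁, t₂, rfl, h₁, h₂⟩

theorem labels_shift {i : ℕ} {w : List Slice} {x y l : List α} {t : List (List α)}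
    (hl : l.length = i) (h : Labels P w x t y) :
    Labels P (shift i w) (l ++ x) (t.map (l ++ ·)) (l ++ y) := by
  induction w generalizing x t with
  | nil => obtain ⟨rfl, rfl⟩ := h; exact ⟨rfl, rfl⟩
  | cons s w ih =>
    obtain ⟨x', t', rfl, h, h'⟩ := h
    exact ⟨l ++ x', t'.map (l ++ ·), rfl, stepLabels_add.2 ⟨l, x, x', hl, rfl, rfl, h⟩, ih h'⟩

theorem exists_of_labels_shift {i : ℕ} {w : List Slice} {x y l : List α} {t : List (List α)}
    (hl : l.length = i) (h : Labels P (shift i w) (l ++ x) t y) :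
    ∃ y' t', y = l ++ y' ∧ t = t'.map (l ++ ·) ∧ Labels P w x t' y' := by
  induction w generalizing x t with
  | nil => obtain ⟨rfl, rfl⟩ := h; exact ⟨x, [], rfl, rfl, rfl, rfl⟩
  | cons s w ih =>
    obtain ⟨x', t', rfl, h, h'⟩ := h
    obtain ⟨l', x₁, x₂, hl', h₁, rfl, h₂⟩ := stepLabels_add.1 h
    obtain ⟨rfl, rfl⟩ := List.append_inj h₁ (hl.trans hl'.symm)
    obtain ⟨y', t'', rfl, rfl, h₃⟩ := ih h'
    exact ⟨y', x :: t'', rfl, rfl, x₂, t'', rfl, h₂, h₃⟩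

theorem Labels.length {w : List Slice} {x y : List α} {t : List (List α)} (h : Labels P w x t y) :
    t.length = w.length := by
  induction w generalizing x t with
  | nil => simp [h.1]
  | cons s w ih => obtain ⟨x', t', rfl, -, h⟩ := h; simp [ih h]

/-- The list `t` omits the labels at the very top, hence the appended `[y]`; the default of `getD`
is never reached. -/
theorem Labels.stepLabels {w : List Slice} {x y : List α} {t : List (List α)}
    (h : Labels P w x t y) {k : ℕ} {s : Slice} (hs : w[k]? = some s) :
    StepLabels P s ((t ++ [y]).getD k []) ((t ++ [y]).getD (k + 1) []) := by
  induction w generalizing x t k with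
  | nil => simp at hs
  | cons s' w ih =>
    obtain ⟨x', t', rfl, h, h'⟩ := h
    rcases k with _ | k
    · obtain rfl : s' = s := by simpa using hs
      have : (t' ++ [y]).getD 0 [] = x' := by
        cases w with
        | nil => obtain ⟨rfl, rfl⟩ := h'; rfl
        | cons s w => obtain ⟨_, _, rfl, _⟩ := h'; rfl
      rw [← this] at h
      exact h
    · exact ih h' (by simpa using hs)

theorem labels_of_stepLabels {w : List Slice} {f : ℕ → List α}
    (h : ∀ k s, w[k]? = some s → StepLabels P s (f k) (f (k + 1))) :
    Labels P w (f 0) ((List.range w.length).map f) (f w.length) := by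
  induction w generalizing f with
  | nil => exact ⟨rfl, rfl⟩
  | cons s w ih =>
    refine ⟨f 1, (List.range w.length).map fun k => f (k + 1), ?_, h 0 s rfl, ?_⟩
    · simp [List.range_succ_eq_map, Function.comp_def]
    · exact ih (f := fun k => f (k + 1)) fun k s hs => h (k + 1) s (by simpa using hs)

theorem stepLabels_of_forall {s : Slice} {n : ℕ} {g h : ℕ → α} (hn : s.pos + s.piece.ins ≤ n)
    (hl : ∀ j < s.pos, g j = h j)
    (hr : ∀ j, s.pos + s.piece.ins + j < n → g (s.pos + s.piece.ins + j) =
      h (s.pos + s.piece.outs + j))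
    (hP : P s.piece ((List.range s.piece.ins).map fun j => g (s.pos + j))
      ((List.range s.piece.outs).map fun j => h (s.pos + j))) :
    StepLabels P s ((List.range n).map g) ((List.range (s.out n)).map h) := by
  obtain ⟨r, rfl⟩ := Nat.exists_eq_add_of_le hn
  have e : s.out (s.pos + s.piece.ins + r) = s.pos + s.piece.outs + r := by
    simp only [Slice.out]; omega
  refine ⟨(List.range s.pos).map g,
    (List.range r).map fun j => g (s.pos + s.piece.ins + j), _, _, by simp, hP, ?_, ?_⟩
  · simp [List.range_add, Function.comp_def, Nat.add_assoc]
  · rw [e]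
    simp only [List.range_add, List.map_append, List.map_map, Function.comp_def]
    congr 1
    · congr 1
      exact List.map_congr_left fun j hj => (hl j (List.mem_range.1 hj)).symm
    · exact List.map_congr_left fun j hj => (hr j (by have := List.mem_range.1 hj; omega)).symm

theorem StepLabels.getElem?_left {s : Slice} {x y : List α} (h : StepLabels P s x y) {j : ℕ}
    (hj : j < s.pos) : x[j]? = y[j]? := by
  obtain ⟨l, r, a, b, hl, -, rfl, rfl⟩ := h
  rw [List.append_assoc, List.append_assoc, List.getElem?_append_left (by omega),
    List.getElem?_append_left (by omega)]

theorem StepLabels.exists_piece {s : Slice} {x y : List α} (h : StepLabels P s x y) :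
    ∃ a b, P s.piece a b ∧ (∀ j < a.length, x[s.pos + j]? = a[j]?) ∧
      (∀ j < b.length, y[s.pos + j]? = b[j]?) ∧
      ∀ j, x[s.pos + a.length + j]? = y[s.pos + b.length + j]? := by
  obtain ⟨l, r, a, b, hl, h, rfl, rfl⟩ := h
  refine ⟨a, b, h, fun j hj => ?_, fun j hj => ?_, fun j => ?_⟩
  · rw [← hl, List.append_assoc, List.getElem?_append_right (by omega),
      List.getElem?_append_left (by omega)]
    simp
  · rw [← hl, List.append_assoc, List.getElem?_append_right (by omega),
      List.getElem?_append_left (by omega)]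
    simp
  · rw [← hl, List.getElem?_append_right (by simp),
      List.getElem?_append_right (by simp)]
    congr 1
    simp

end

/-! Labellings that are constant along the strands of a link -/

/-- Each strand of a piece carries a single label. -/
inductive StrandLabels {α : Type*} : Piece → List α → List α → Prop
  | cup (c : α) : StrandLabels .cup [] [c, c]
  | cap (c : α) : StrandLabels .cap [c, c] []
  | crossing (b : Bool) (c d : α) : StrandLabels (.crossing b) [c, d] [d, c]

section
variable {α : Type*}

theorem strandLabels_cup {a b : List α} :
    StrandLabels .cup a b ↔ ∃ c, a = [] ∧ b = [c, c] :=
  ⟨by rintro ⟨⟩; exact ⟨_, rfl, rfl⟩, by rintro ⟨c, rfl, rfl⟩; exact .cup c⟩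

theorem strandLabels_cap {a b : List α} :
    StrandLabels .cap a b ↔ ∃ c, a = [c, c] ∧ b = [] :=
  ⟨by rintro ⟨⟩; exact ⟨_, rfl, rfl⟩, by rintro ⟨c, rfl, rfl⟩; exact .cap c⟩

theorem strandLabels_crossing {e : Bool} {a b : List α} :
    StrandLabels (.crossing e) a b ↔ ∃ c d, a = [c, d] ∧ b = [d, c] :=
  ⟨by rintro ⟨⟩; exact ⟨_, _, rfl, rfl⟩, by rintro ⟨c, d, rfl, rfl⟩; exact .crossing e c d⟩

theorem StrandLabels.length {q : Piece} {a b : List α} (h : StrandLabels q a b) :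
    a.length = q.ins ∧ b.length = q.outs := by
  cases h <;> exact ⟨rfl, rfl⟩

/-- All labels in a list are equal to `c`. -/
abbrev AllEq (c : α) (x : List α) : Prop := ∀ z ∈ x, z = c

/-- Labellings of `a` can be replaced by labellings of `b`, and are constant if they are so at both
ends. -/
def Replaceable (α : Type*) (n : ℕ) (a b : List Slice) : Prop :=
  ∀ (x y : List α) (t : List (List α)), x.length = n → Labels StrandLabels a x t y →
    (∃ t', Labels StrandLabels b x t' y) ∧ ∀ c, AllEq c x → AllEq c y → ∀ l ∈ t, AllEq c l

theorem Replaceable.shift {n : ℕ} {a b : List Slice} (h : Replaceable α n a b) (i : ℕ) :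
    Replaceable α (i + n) (shift i a) (shift i b) := by
  intro x y t hx ht
  obtain ⟨l, x, hl, hn, rfl⟩ : ∃ l x', l.length = i ∧ x'.length = n ∧ x = l ++ x' :=
    ⟨x.take i, x.drop i, by simp [hx], by simp [hx], by simp⟩
  obtain ⟨y, t, rfl, rfl, h'⟩ := exists_of_labels_shift hl ht
  obtain ⟨⟨t', ht'⟩, hc⟩ := h x y t hn h'
  refine ⟨⟨_, labels_shift hl ht'⟩, fun c hx hy m hm => ?_⟩
  obtain ⟨m, hm', rfl⟩ := List.mem_map.1 hm
  have := hc c (fun z hz => hx z (by simp [hz])) (fun z hz => hy z (by simp [hz])) m hm'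
  intro z hz
  rcases List.mem_append.1 hz with hz | hz
  · exact hx z (by simp [hz])
  · exact this z hz

theorem replaceable_exchange (a b : Piece) (d n : ℕ) :
    Replaceable α n [⟨a, 0⟩, ⟨b, a.outs + d⟩] [⟨b, a.ins + d⟩, ⟨a, 0⟩] := by
  rintro x y t - ⟨x', t, rfl, h₁, y', t, rfl, h₂, rfl, rfl⟩
  obtain ⟨p, p', r, hp, rfl, rfl⟩ := stepLabels_zero.1 h₁
  obtain ⟨l, x', y', hl, e, rfl, h⟩ := stepLabels_add.1 h₂
  obtain ⟨rfl, rfl⟩ := List.append_inj e (hp.length.2.trans hl.symm)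
  refine ⟨⟨[p ++ r, p ++ y'], p ++ y', _, rfl, stepLabels_add.2 ⟨p, r, y', hp.length.1, rfl, rfl, h⟩,
    p' ++ y', _, rfl, stepLabels_zero.2 ⟨p, p', y', hp, rfl, rfl⟩, rfl, rfl⟩, ?_⟩
  intro c hx hy
  simp only [AllEq, List.mem_cons, List.not_mem_nil, or_false, forall_eq_or_imp, forall_eq,
    List.mem_append] at *
  -- The labels between the two slices are those of the top on the left and those of the bottom on
  -- the right.
  exact ⟨hx, fun z hz => hz.elim (fun h => hy z (.inl h)) fun h => hx z (.inr h)⟩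

theorem replaceable_exchange_symm (a b : Piece) (d n : ℕ) :
    Replaceable α n [⟨b, a.ins + d⟩, ⟨a, 0⟩] [⟨a, 0⟩, ⟨b, a.outs + d⟩] := by
  rintro x y t - ⟨x', t, rfl, h₂, y', t, rfl, h₁, rfl, rfl⟩
  obtain ⟨p, p', r, hp, rfl, rfl⟩ := stepLabels_zero.1 h₁
  obtain ⟨l, x', y', hl, rfl, e, h⟩ := stepLabels_add.1 h₂
  obtain ⟨rfl, rfl⟩ := List.append_inj e (hp.length.1.trans hl.symm)
  refine ⟨⟨[p ++ x', p' ++ x'], p' ++ x', _, rfl, stepLabels_zero.2 ⟨p, p', x', hp, rfl, rfl⟩,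
    p' ++ r, _, rfl, stepLabels_add.2 ⟨p', x', r, hp.length.2, rfl, rfl, h⟩, rfl, rfl⟩, ?_⟩
  intro c hx hy
  simp only [AllEq, List.mem_cons, List.not_mem_nil, or_false, forall_eq_or_imp, forall_eq,
    List.mem_append] at *
  exact ⟨hx, fun z hz => hz.elim (fun h => hx z (.inl h)) fun h => hy z (.inr h)⟩

section

set_option linter.unusedSimpArgs false

theorem replaceable_zigzag (n : ℕ) :
    Replaceable α n [cup 0, cap 1] [] := by
  intro x y t hx h
  simp only [Labels, stepLabels_zero, stepLabels_one, strandLabels_cup, strandLabels_cap,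
    strandLabels_crossing, AllEq] at h ⊢
  aesop

theorem replaceable_zigzag_symm (n : ℕ) :
    Replaceable α (n + 1) [] [cup 0, cap 1] := by
  intro x y t hx h
  -- The strand that is to be bent has to exist, whence `n + 1`.
  obtain ⟨c, r, rfl⟩ := List.exists_of_length_succ _ hx
  simp only [Labels, stepLabels_zero, stepLabels_one, strandLabels_cup, strandLabels_cap,
    strandLabels_crossing, AllEq] at h ⊢
  aesop

theorem replaceable_zagzig (n : ℕ) :
    Replaceable α n [cup 1, cap 0] [] := by
  intro x y t hx h
  simp only [Labels, stepLabels_zero, stepLabels_one, strandLabels_cup, strandLabels_cap,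
    strandLabels_crossing, AllEq] at h ⊢
  aesop

theorem replaceable_zagzig_symm (n : ℕ) :
    Replaceable α (n + 1) [] [cup 1, cap 0] := by
  intro x y t hx h
  obtain ⟨c, r, rfl⟩ := List.exists_of_length_succ _ hx
  simp only [Labels, stepLabels_zero, stepLabels_one, strandLabels_cup, strandLabels_cap,
    strandLabels_crossing, AllEq] at h ⊢
  aesop

theorem replaceable_slideCup (b : Bool) (n : ℕ) :
    Replaceable α n [cup 0, cross b 1] [cup 1, cross (!b) 0] := by
  intro x y t hx h
  simp only [Labels, stepLabels_zero, stepLabels_one, strandLabels_cup, strandLabels_cap,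
    strandLabels_crossing, AllEq] at h ⊢
  aesop

theorem replaceable_slideCup_symm (b : Bool) (n : ℕ) :
    Replaceable α n [cup 1, cross (!b) 0] [cup 0, cross b 1] := by
  intro x y t hx h
  simp only [Labels, stepLabels_zero, stepLabels_one, strandLabels_cup, strandLabels_cap,
    strandLabels_crossing, AllEq] at h ⊢
  aesop

theorem replaceable_slideCap (b : Bool) (n : ℕ) :
    Replaceable α n [cross b 1, cap 0] [cross (!b) 0, cap 1] := by
  intro x y t hx h
  simp only [Labels, stepLabels_zero, stepLabels_one, strandLabels_cup, strandLabels_cap,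
    strandLabels_crossing, AllEq] at h ⊢
  aesop

theorem replaceable_slideCap_symm (b : Bool) (n : ℕ) :
    Replaceable α n [cross (!b) 0, cap 1] [cross b 1, cap 0] := by
  intro x y t hx h
  simp only [Labels, stepLabels_zero, stepLabels_one, strandLabels_cup, strandLabels_cap,
    strandLabels_crossing, AllEq] at h ⊢
  aesop

theorem replaceable_reidemeister₁Cup (b : Bool) (n : ℕ) :
    Replaceable α n [cup 0, cross b 0] [cup 0] := by
  intro x y t hx h
  simp only [Labels, stepLabels_zero, stepLabels_one, strandLabels_cup, strandLabels_cap,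
    strandLabels_crossing, AllEq] at h ⊢
  aesop

theorem replaceable_reidemeister₁Cup_symm (b : Bool) (n : ℕ) :
    Replaceable α n [cup 0] [cup 0, cross b 0] := by
  intro x y t hx h
  simp only [Labels, stepLabels_zero, stepLabels_one, strandLabels_cup, strandLabels_cap,
    strandLabels_crossing, AllEq] at h ⊢
  aesop

theorem replaceable_reidemeister₁Cap (b : Bool) (n : ℕ) :
    Replaceable α n [cross b 0, cap 0] [cap 0] := by
  intro x y t hx h
  simp only [Labels, stepLabels_zero, stepLabels_one, strandLabels_cup, strandLabels_cap,
    strandLabels_crossing, AllEq] at h ⊢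
  aesop

theorem replaceable_reidemeister₁Cap_symm (b : Bool) (n : ℕ) :
    Replaceable α n [cap 0] [cross b 0, cap 0] := by
  intro x y t hx h
  simp only [Labels, stepLabels_zero, stepLabels_one, strandLabels_cup, strandLabels_cap,
    strandLabels_crossing, AllEq] at h ⊢
  aesop

theorem replaceable_reidemeister₂ (b : Bool) (n : ℕ) :
    Replaceable α n [cross b 0, cross (!b) 0] [] := by
  intro x y t hx h
  simp only [Labels, stepLabels_zero, stepLabels_one, strandLabels_cup, strandLabels_cap,
    strandLabels_crossing, AllEq] at h ⊢
  aesop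

theorem replaceable_reidemeister₂_symm (b : Bool) (n : ℕ) :
    Replaceable α (n + 2) [] [cross b 0, cross (!b) 0] := by
  intro x y t hx h
  obtain ⟨c, r, rfl⟩ := List.exists_of_length_succ _ hx
  obtain ⟨d, r, rfl⟩ := List.exists_of_length_succ (n := n) r (by simpa using hx)
  simp only [Labels, stepLabels_zero, stepLabels_one, strandLabels_cup, strandLabels_cap,
    strandLabels_crossing, AllEq] at h ⊢
  aesop

theorem replaceable_reidemeister₃ (b : Bool) (n : ℕ) :
    Replaceable α n [cross b 0, cross b 1, cross b 0] [cross b 1, cross b 0, cross b 1] := by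
  intro x y t hx h
  simp only [Labels, stepLabels_zero, stepLabels_one, strandLabels_cup, strandLabels_cap,
    strandLabels_crossing, AllEq] at h ⊢
  aesop

theorem replaceable_reidemeister₃_symm (b : Bool) (n : ℕ) :
    Replaceable α n [cross b 1, cross b 0, cross b 1] [cross b 0, cross b 1, cross b 0] := by
  intro x y t hx h
  simp only [Labels, stepLabels_zero, stepLabels_one, strandLabels_cup, strandLabels_cap,
    strandLabels_crossing, AllEq] at h ⊢
  aesop

end

/-- Both sides of a move join their ends in the same pairs, and neither side contains a closed
component. -/
theorem LocalMove.replaceable {a b : List Slice} (h : LocalMove a b) {n m : ℕ} (ha : Fits n a m) :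
    Replaceable α n a b ∧ Replaceable α n b a := by
  cases h with
  | exchange a b i d =>
    obtain ⟨r, rfl⟩ : ∃ r, n = i + r := Nat.exists_eq_add_of_le (by have := ha.1; simp only at this; omega)
    have h1 := (replaceable_exchange (α := α) a b d r).shift i
    have h2 := (replaceable_exchange_symm (α := α) a b d r).shift i
    simp only [shift_cons, shift_nil, ← Nat.add_assoc] at h1 h2
    exact ⟨h1, h2⟩
  | zigzag i =>
    obtain ⟨r, rfl⟩ : ∃ r, n = i + (r + 1) :=
      ⟨n - i - 1, by simp [Fits, Slice.out, Piece.ins, Piece.outs] at ha; omega⟩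
    exact ⟨(replaceable_zigzag _).shift i, (replaceable_zigzag_symm _).shift i⟩
  | zagzig i =>
    obtain ⟨r, rfl⟩ : ∃ r, n = i + (r + 1) :=
      ⟨n - i - 1, by simp [Fits, Slice.out, Piece.ins, Piece.outs] at ha; omega⟩
    exact ⟨(replaceable_zagzig _).shift i, (replaceable_zagzig_symm _).shift i⟩
  | slideCup b i =>
    obtain ⟨r, rfl⟩ : ∃ r, n = i + r :=
      ⟨n - i - 0, by simp [Fits, Slice.out, Piece.ins, Piece.outs] at ha; omega⟩
    exact ⟨(replaceable_slideCup _ _).shift i, (replaceable_slideCup_symm _ _).shift i⟩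
  | slideCap b i =>
    obtain ⟨r, rfl⟩ : ∃ r, n = i + r :=
      ⟨n - i - 0, by simp [Fits, Slice.out, Piece.ins, Piece.outs] at ha; omega⟩
    exact ⟨(replaceable_slideCap _ _).shift i, (replaceable_slideCap_symm _ _).shift i⟩
  | reidemeister₁Cup b i =>
    obtain ⟨r, rfl⟩ : ∃ r, n = i + r :=
      ⟨n - i - 0, by simp [Fits, Slice.out, Piece.ins, Piece.outs] at ha; omega⟩
    exact ⟨(replaceable_reidemeister₁Cup _ _).shift i, (replaceable_reidemeister₁Cup_symm _ _).shift i⟩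
  | reidemeister₁Cap b i =>
    obtain ⟨r, rfl⟩ : ∃ r, n = i + r :=
      ⟨n - i - 0, by simp [Fits, Slice.out, Piece.ins, Piece.outs] at ha; omega⟩
    exact ⟨(replaceable_reidemeister₁Cap _ _).shift i, (replaceable_reidemeister₁Cap_symm _ _).shift i⟩
  | reidemeister₂ b i =>
    obtain ⟨r, rfl⟩ : ∃ r, n = i + (r + 2) :=
      ⟨n - i - 2, by simp [Fits, Slice.out, Piece.ins, Piece.outs] at ha; omega⟩
    exact ⟨(replaceable_reidemeister₂ _ _).shift i, (replaceable_reidemeister₂_symm _ _).shift i⟩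
  | reidemeister₃ b i =>
    obtain ⟨r, rfl⟩ : ∃ r, n = i + r :=
      ⟨n - i - 0, by simp [Fits, Slice.out, Piece.ins, Piece.outs] at ha; omega⟩
    exact ⟨(replaceable_reidemeister₃ _ _).shift i, (replaceable_reidemeister₃_symm _ _).shift i⟩

end

/-! Invariance of the number of components -/

theorem Labels.length_of_fits {α : Type*} {w : List Slice} {x y : List α} {t : List (List α)} {n m : ℕ}
    (h : Labels StrandLabels w x t y) (hw : Fits n w m) (hx : x.length = n) : y.length = m := by
  induction w generalizing x t n with
  | nil => obtain ⟨rfl, rfl⟩ := h; exact hx.trans hw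
  | cons s w ih =>
    obtain ⟨x', t', rfl, ⟨l, r, a, b, hl, hP, rfl, rfl⟩, h⟩ := h
    refine ih h hw.2 ?_
    have := hP.length
    simp only [List.length_append, Slice.out] at hx ⊢
    omega

theorem Labels.mem_or_eq {α : Type*} {P : Piece → List α → List α → Prop} {w : List Slice}
    {x y : List α} {t : List (List α)} (h : Labels P w x t y) : x ∈ t ∨ x = y := by
  cases w with
  | nil => exact .inr h.2
  | cons s w => obtain ⟨x', t', rfl, -⟩ := h; simp

/-- Every labelling of the points by truth values that is constant along the strands is constant. -/
def ConstLabels (w : List Slice) : Prop :=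
  ∀ t : List (List Bool), Labels StrandLabels w [] t [] → ∃ c, ∀ l ∈ t, AllEq c l

/-- A labelling of the word with `a` yields one of the word with `b` that agrees with it outside.
The latter is constant, so the labels at both ends of `a` are, and hence those inside `a`. -/
theorem ConstLabels.of_replaceable {u v a b : List Slice} {n : ℕ}
    (h : ConstLabels (u ++ b ++ v)) (hu : Fits 0 u n)
    (hab : Replaceable Bool n a b) : ConstLabels (u ++ a ++ v) := by
  intro t ht
  obtain ⟨y, t', t₃, rfl, ht', h₃⟩ := labels_append.1 ht
  obtain ⟨x, t₁, t₂, rfl, h₁, h₂⟩ := labels_append.1 ht'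
  obtain ⟨⟨t₂', h₂'⟩, hc⟩ := hab x y t₂ (h₁.length_of_fits hu rfl) h₂
  obtain ⟨c, hc'⟩ := h _ (labels_append.2 ⟨y, _, t₃, rfl, labels_append.2
    ⟨x, t₁, t₂', rfl, h₁, h₂'⟩, h₃⟩)
  -- The level `y` is recorded as the bottom of `v`, unless `v` is empty, and then there are no
  -- strands. The level `x` is treated likewise.
  have hy : AllEq c y := by
    rcases h₃.mem_or_eq with hy | rfl
    · exact hc' y (by simp [hy])
    · simp
  have hx : AllEq c x := by
    rcases h₂'.mem_or_eq with hx | rfl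
    · exact hc' x (by simp [hx])
    · exact hy
  refine ⟨c, fun l hl => ?_⟩
  simp only [List.mem_append] at hl hc'
  rcases hl with (hl | hl) | hl
  · exact hc' l (.inl (.inl hl))
  · exact hc c hx hy l hl
  · exact hc' l (.inr hl)

theorem LinkDiagram.Move.constLabels_iff {D E : LinkDiagram} (h : D.Move E) :
    ConstLabels D.word ↔ ConstLabels E.word := by
  obtain ⟨u, v, a, b, hab, hD, hE⟩ := h
  have hf := D.closed
  rw [hD, List.append_assoc, fits_append] at hf
  obtain ⟨k, hu, hf⟩ := hf
  obtain ⟨m, ha, hv⟩ := fits_append.1 hf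
  obtain ⟨h1, h2⟩ := hab.replaceable (α := Bool) ha
  rw [hD, hE]
  exact ⟨fun h => h.of_replaceable hu h2, fun h => h.of_replaceable hu h1⟩

/-! ### Labels as functions on the points of a diagram -/

section
variable {α : Type*}

theorem Labels.length_getD {w : List Slice} {t : List (List α)}
    {P : Piece → List α → List α → Prop}
    (hP : ∀ q a b, P q a b → a.length = q.ins ∧ b.length = q.outs)
    (h : Labels P w [] t []) {k : ℕ} (hk : k ≤ w.length) :
    ((t ++ [[]]).getD k []).length = width w k := by
  induction k with
  | zero =>
    cases w with
    | nil => obtain ⟨rfl, -⟩ := h; rfl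
    | cons s w => obtain ⟨_, _, rfl, _⟩ := h; rfl
  | succ k ih =>
    have hs : w[k]? = some w[k] := List.getElem?_eq_getElem hk
    obtain ⟨l, r, a, b, hl, hab, h1, h2⟩ := h.stepLabels hs
    have h3 := hP _ _ _ hab
    have h4 := ih (by omega)
    obtain ⟨h5, -⟩ := eq_take_append_of_getElem? hs
    rw [width, h5, List.foldl_append]
    change _ = (w[k]).out (width w k)
    rw [h2, ← h4, h1]
    simp only [Slice.out, List.length_append]
    omega

theorem LinkDiagram.width_eq_zero (D : LinkDiagram) {k : ℕ} (hk : D.word.length ≤ k) :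
    width D.word k = 0 := by
  rw [width, List.take_of_length_le hk]
  exact D.closed.foldl_out

theorem LinkDiagram.lt_length (D : LinkDiagram) (p : D.Point) : p.1.1 < D.word.length := by
  by_contra h
  have := p.2
  rw [D.width_eq_zero (not_lt.1 h)] at this
  omega

instance (D : LinkDiagram) : Finite D.Point := by
  refine Finite.of_injective (β := Σ k : Fin D.word.length, Fin (width D.word k))
    (fun p => ⟨⟨p.1.1, D.lt_length p⟩, ⟨p.1.2, p.2⟩⟩) ?_
  rintro ⟨⟨k, j⟩, hp⟩ ⟨⟨k', j'⟩, hq⟩ h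
  simp only [Sigma.mk.injEq, Fin.mk.injEq] at h
  obtain ⟨rfl, h⟩ := h
  simp only [heq_eq_eq, Fin.mk.injEq] at h
  subst h
  rfl

/-- The label of a point of a diagram. -/
def labelAt [Inhabited α] (t : List (List α)) (p : ℕ × ℕ) : α := ((t ++ [[]]).getD p.1 []).getD p.2 default

theorem Labels.labelAt_passes [Inhabited α] {w : List Slice} {t : List (List α)}
    {P : Piece → List α → List α → Prop}
    (hP : ∀ q a b, P q a b → a.length = q.ins ∧ b.length = q.outs)
    (h : Labels P w [] t []) {p q : ℕ × ℕ} (hpq : Passes w p q) : labelAt t p = labelAt t q := by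
  cases hpq with
  | left hs hj =>
    simp only [labelAt]
    rw [List.getD_eq_getElem?_getD, (h.stepLabels hs).getElem?_left hj, ← List.getD_eq_getElem?_getD]
  | right hs =>
    obtain ⟨a, b, hab, -, -, h3⟩ := (h.stepLabels hs).exists_piece
    rw [(hP _ _ _ hab).1, (hP _ _ _ hab).2] at h3
    simp only [labelAt]
    rw [List.getD_eq_getElem?_getD, h3, ← List.getD_eq_getElem?_getD]

theorem Labels.exists_labelAt [Inhabited α] {w : List Slice} {t : List (List α)}
    {P : Piece → List α → List α → Prop} (h : Labels P w [] t []) {k : ℕ} {s : Slice}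
    (hs : w[k]? = some s) : ∃ a b, P s.piece a b ∧
      (∀ j < a.length, labelAt t (k, s.pos + j) = a.getD j default) ∧
      ∀ j < b.length, labelAt t (k + 1, s.pos + j) = b.getD j default := by
  obtain ⟨a, b, hab, h1, h2, -⟩ := (h.stepLabels hs).exists_piece
  refine ⟨a, b, hab, fun j hj => ?_, fun j hj => ?_⟩
  · simp only [labelAt, List.getD_eq_getElem?_getD] at h1 ⊢
    rw [h1 j hj]
  · simp only [labelAt, List.getD_eq_getElem?_getD] at h2 ⊢
    rw [h2 j hj]

theorem LinkDiagram.exists_point_of_mem {D : LinkDiagram} {t : List (List α)} [Inhabited α]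
    {P : Piece → List α → List α → Prop}
    (hP : ∀ q a b, P q a b → a.length = q.ins ∧ b.length = q.outs)
    (h : Labels P D.word [] t []) {l : List α} (hl : l ∈ t) {z : α} (hz : z ∈ l) :
    ∃ p : D.Point, labelAt t p.1 = z := by
  obtain ⟨k, hk, rfl⟩ := List.mem_iff_getElem.1 hl
  obtain ⟨j, hj, rfl⟩ := List.mem_iff_getElem.1 hz
  have h1 := h.length_getD hP (k := k) (by rw [← h.length]; omega)
  have h2 : (t ++ [[]]).getD k [] = t[k] := by
    rw [List.getD_eq_getElem?_getD, List.getElem?_append_left hk]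
    simp [hk]
  refine ⟨⟨(k, j), ?_⟩, ?_⟩
  · simpa only [← h1, h2] using hj
  · simp only [labelAt, h2]
    simp [hj]

end

/-- The labellings by truth values that are constant along strands are the indicator functions of
unions of components. In this form connectedness can be compared locally before and after a move. -/
theorem LinkDiagram.connected_iff (D : LinkDiagram) : D.Connected ↔ ConstLabels D.word := by
  constructor
  · intro h t ht
    have hP : ∀ q (a b : List Bool), StrandLabels q a b → a.length = q.ins ∧ b.length = q.outs :=
      fun _ _ _ h => h.length
    have hr : ∀ p q : D.Point, (Passes D.word p.1 q.1 ∨ Turns D.word p.1 q.1 ∨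
        Crosses D.word p.1 q.1) → labelAt t p.1 = labelAt t q.1 := by
      rintro ⟨p, hp⟩ ⟨q, hq⟩ (hpq | hpq | hpq)
      · exact ht.labelAt_passes hP hpq
      · cases hpq with
        | cup hs =>
          obtain ⟨a, b, hab, h1, h2⟩ := ht.exists_labelAt hs
          cases hab
          exact (h2 0 (by simp)).trans (h2 1 (by simp)).symm
        | cap hs =>
          obtain ⟨a, b, hab, h1, h2⟩ := ht.exists_labelAt hs
          cases hab
          exact (h1 0 (by simp)).trans (h1 1 (by simp)).symm
      · cases hpq with
        | right hs =>
          obtain ⟨a, b, hab, h1, h2⟩ := ht.exists_labelAt hs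
          cases hab
          exact (h1 0 (by simp)).trans (h2 1 (by simp)).symm
        | left hs =>
          obtain ⟨a, b, hab, h1, h2⟩ := ht.exists_labelAt hs
          cases hab
          exact (h1 1 (by simp)).trans (h2 0 (by simp)).symm
    have hall : ∀ p q : D.Point, labelAt t p.1 = labelAt t q.1 := fun p q =>
      congrArg (Quot.lift (fun p : D.Point => labelAt t p.1) hr) (h.elim (Quot.mk _ p) (Quot.mk _ q))
    by_cases hne : Nonempty D.Point
    · obtain ⟨p⟩ := hne
      refine ⟨labelAt t p.1, fun l hl z hz => ?_⟩
      obtain ⟨q, rfl⟩ := D.exists_point_of_mem hP ht hl hz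
      exact hall q p
    · refine ⟨true, fun l hl z hz => ?_⟩
      obtain ⟨q, -⟩ := D.exists_point_of_mem hP ht hl hz
      exact (hne ⟨q⟩).elim
  · intro h
    refine ⟨fun x y => ?_⟩
    obtain ⟨p, rfl⟩ := Quot.exists_rep x
    obtain ⟨q, rfl⟩ := Quot.exists_rep y
    classical
    let r := fun p q : D.Point =>
      Passes D.word p.1 q.1 ∨ Turns D.word p.1 q.1 ∨ Crosses D.word p.1 q.1
    -- The indicator function of the component of `p`, with an irrelevant value off the diagram.
    let g : ℕ × ℕ → Bool := fun z =>
      if hz : z.2 < width D.word z.1 then decide (Quot.mk r ⟨z, hz⟩ = Quot.mk r p) else true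
    have hgr : ∀ z : D.Point, g z.1 = decide (Quot.mk r z = Quot.mk r p) := fun z => dif_pos z.2
    have hg : ∀ z z' : D.Point, r z z' → g z.1 = g z'.1 := fun z z' hr => by
      rw [hgr, hgr, Quot.sound hr]
    have hl := labels_of_stepLabels (P := StrandLabels) (w := D.word)
      (f := fun k => (List.range (width D.word k)).map fun j => g (k, j)) (by
      intro k s hs
      obtain ⟨h1, h2⟩ := D.fits_slice hs
      rw [h2]
      refine stepLabels_of_forall h1 (fun j hj => ?_) (fun j hj => ?_) ?_
      · exact hg ⟨(k, j), by simp only; omega⟩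
          ⟨(k + 1, j), by simp only [h2, Slice.out]; omega⟩ (.inl (.left hs hj))
      · exact hg ⟨(k, s.pos + s.piece.ins + j), hj⟩
          ⟨(k + 1, s.pos + s.piece.outs + j), by simp only [h2, Slice.out]; omega⟩
          (.inl (.right hs))
      · obtain ⟨q, i⟩ := s
        cases q with
        | cup =>
          have := hg ⟨(k + 1, i), by simp only [h2, Slice.out, Piece.ins, Piece.outs] at h1 ⊢; omega⟩
            ⟨(k + 1, i + 1), by simp only [h2, Slice.out, Piece.ins, Piece.outs] at h1 ⊢; omega⟩ (.inr (.inl (.cup hs)))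
          simp only at this
          simpa [Piece.ins, Piece.outs, List.range_succ, this] using StrandLabels.cup _
        | cap =>
          have := hg ⟨(k, i), by simp only [Piece.ins] at h1 ⊢; omega⟩
            ⟨(k, i + 1), by simp only [Piece.ins] at h1 ⊢; omega⟩ (.inr (.inl (.cap hs)))
          simp only at this
          simpa [Piece.ins, Piece.outs, List.range_succ, this] using StrandLabels.cap _
        | crossing b =>
          have e1 := hg ⟨(k, i), by simp only [Piece.ins] at h1 ⊢; omega⟩
            ⟨(k + 1, i + 1), by simp only [h2, Slice.out, Piece.outs]; simp only [Piece.ins] at h1 ⊢; omega⟩ (.inr (.inr (.right hs)))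
          have e2 := hg ⟨(k, i + 1), by simp only [Piece.ins] at h1 ⊢; omega⟩
            ⟨(k + 1, i), by simp only [h2, Slice.out, Piece.outs]; simp only [Piece.ins] at h1 ⊢; omega⟩ (.inr (.inr (.left hs)))
          simp only at e1 e2
          simpa [Piece.ins, Piece.outs, List.range_succ, e1, e2] using StrandLabels.crossing b _ _)
    have e0 : width D.word 0 = 0 := rfl
    simp only [e0, D.width_eq_zero le_rfl, List.range_zero, List.map_nil] at hl
    obtain ⟨c, hc⟩ := h _ hl
    have hgc : ∀ z : D.Point, g z.1 = c := fun z =>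
      hc _ (List.mem_map.2 ⟨z.1.1, List.mem_range.2 (D.lt_length z), rfl⟩) _
        (List.mem_map.2 ⟨z.1.2, List.mem_range.2 z.2, rfl⟩)
    have h3 := (hgc q).trans (hgc p).symm
    rw [hgr, hgr] at h3
    exact (by simpa using h3 : Quot.mk r q = Quot.mk r p).symm

theorem LinkDiagram.Move.connected_iff {D E : LinkDiagram} (h : D.Move E) :
    D.Connected ↔ E.Connected := by
  rw [D.connected_iff, E.connected_iff, h.constLabels_iff]

theorem LinkDiagram.Isotopic.connected_iff {D E : LinkDiagram} (h : D.Isotopic E) :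
    D.Connected ↔ E.Connected := by
  induction h with
  | rel D E h => exact h.connected_iff
  | refl D => rfl
  | symm D E _ ih => exact ih.symm
  | trans D E F _ _ ih ih' => exact ih.trans ih'

theorem LinkDiagram.components_eq_one_iff (D : LinkDiagram) :
    D.components = 1 ↔ D.Connected ∧ Nonempty D.Point := by
  rw [components, Nat.card_eq_one_iff_unique]
  exact and_congr Iff.rfl ⟨fun ⟨x⟩ => ⟨x.exists_rep.choose⟩, fun ⟨p⟩ => ⟨Quot.mk _ p⟩⟩


/-! Orientations and Seifert circles -/

/-- Labels consisting of an orientation and a label that is constant along Seifert circles. -/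
inductive SeifertLabels : Piece → List (Bool × ℕ) → List (Bool × ℕ) → Prop
  | cup (o : Bool) (c : ℕ) : SeifertLabels .cup [] [(o, c), (!o, c)]
  | cap (o : Bool) (c : ℕ) : SeifertLabels .cap [(o, c), (!o, c)] []
  | parallel (b o : Bool) (c d : ℕ) :
      SeifertLabels (.crossing b) [(o, c), (o, d)] [(o, c), (o, d)]
  | opposite (b o : Bool) (c d : ℕ) :
      SeifertLabels (.crossing b) [(o, c), (!o, c)] [(!o, d), (o, d)]

theorem SeifertLabels.length {q : Piece} {a b : List (Bool × ℕ)} (h : SeifertLabels q a b) :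
    a.length = q.ins ∧ b.length = q.outs := by
  cases h <;> exact ⟨rfl, rfl⟩

theorem SeifertLabels.map {q : Piece} {a b : List (Bool × ℕ)} (h : SeifertLabels q a b)
    (f : ℕ → ℕ) : SeifertLabels q (a.map (Prod.map id f)) (b.map (Prod.map id f)) := by
  cases h
  · exact .cup _ _
  · exact .cap _ _
  · exact .parallel _ _ _ _
  · exact .opposite _ _ _ _

/-- The labels of Seifert circles that occur. -/
def colours (t : List (List (Bool × ℕ))) : Finset ℕ := (t.flatten.map Prod.snd).toFinset

theorem mem_colours {t : List (List (Bool × ℕ))} {c : ℕ} :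
    c ∈ colours t ↔ ∃ l ∈ t, c ∈ l.map Prod.snd := by
  simp only [colours, List.mem_toFinset, List.mem_map, List.mem_flatten]
  constructor
  · rintro ⟨a, ⟨l, hl, ha⟩, rfl⟩
    exact ⟨l, hl, a, ha, rfl⟩
  · rintro ⟨l, hl, a, ha, rfl⟩
    exact ⟨a, ⟨l, hl, ha⟩, rfl⟩

@[simp] theorem colours_nil : colours [] = ∅ := rfl

@[simp] theorem colours_append (t t' : List (List (Bool × ℕ))) :
    colours (t ++ t') = colours t ∪ colours t' := by
  ext; simp [colours]

@[simp] theorem colours_cons (l : List (Bool × ℕ)) (t : List (List (Bool × ℕ))) :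
    colours (l :: t) = (l.map Prod.snd).toFinset ∪ colours t := by
  ext; simp [colours]

/-- A labelling by Seifert circles gives a lower bound for their number. -/
theorem LinkDiagram.exists_orientation {D : LinkDiagram} {t : List (List (Bool × ℕ))}
    (h : Labels SeifertLabels D.word [] t []) :
    ∃ o : D.Orientation, (colours t).card ≤ D.seifertCircles o := by
  have hP : ∀ q a b, SeifertLabels q a b → a.length = q.ins ∧ b.length = q.outs :=
    fun _ _ _ h => h.length
  let o : D.Orientation :=
    { up := fun p => (labelAt t p).1
      passes := fun p q hpq => congrArg Prod.fst (h.labelAt_passes hP hpq)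
      crosses := by
        rintro ⟨p, hp⟩ ⟨q, hq⟩ hpq
        cases hpq with
        | right hs =>
          obtain ⟨a, b, hab, h1, h2⟩ := h.exists_labelAt hs
          cases hab <;>
          exact (congrArg Prod.fst (h1 0 (by simp))).trans (congrArg Prod.fst (h2 1 (by simp))).symm
        | left hs =>
          obtain ⟨a, b, hab, h1, h2⟩ := h.exists_labelAt hs
          cases hab <;>
          exact (congrArg Prod.fst (h1 1 (by simp))).trans (congrArg Prod.fst (h2 0 (by simp))).symm
      turns := by
        rintro ⟨p, hp⟩ ⟨q, hq⟩ hpq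
        cases hpq with
        | cup hs =>
          obtain ⟨a, b, hab, h1, h2⟩ := h.exists_labelAt hs
          cases hab with | cup o c => ?_
          have e1 := congrArg Prod.fst (h2 0 (by simp))
          have e2 := congrArg Prod.fst (h2 1 (by simp))
          simp at e1 e2 ⊢
          simp [e1, e2]
        | cap hs =>
          obtain ⟨a, b, hab, h1, h2⟩ := h.exists_labelAt hs
          cases hab with | cap o c => ?_
          have e1 := congrArg Prod.fst (h1 0 (by simp))
          have e2 := congrArg Prod.fst (h1 1 (by simp))
          simp at e1 e2 ⊢
          simp [e1, e2] }
  refine ⟨o, ?_⟩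
  have hr : ∀ p q : D.Point, (Passes D.word p.1 q.1 ∨ Turns D.word p.1 q.1 ∨
      Smooths D.word o.up p.1 q.1) → (labelAt t p.1).2 = (labelAt t q.1).2 := by
    rintro ⟨p, hp⟩ ⟨q, hq⟩ (hpq | hpq | hpq)
    · exact congrArg Prod.snd (h.labelAt_passes hP hpq)
    · cases hpq with
      | cup hs =>
        obtain ⟨a, b, hab, h1, h2⟩ := h.exists_labelAt hs
        cases hab
        exact (congrArg Prod.snd (h2 0 (by simp))).trans (congrArg Prod.snd (h2 1 (by simp))).symm
      | cap hs =>
        obtain ⟨a, b, hab, h1, h2⟩ := h.exists_labelAt hs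
        cases hab
        exact (congrArg Prod.snd (h1 0 (by simp))).trans (congrArg Prod.snd (h1 1 (by simp))).symm
    · have key : ∀ {k i : ℕ} {b : Bool}, D.word[k]? = some (cross b i) →
          (o.up (k, i) = o.up (k, i + 1) → (labelAt t (k, i)).2 = (labelAt t (k + 1, i)).2 ∧
            (labelAt t (k, i + 1)).2 = (labelAt t (k + 1, i + 1)).2) ∧
          (o.up (k, i) ≠ o.up (k, i + 1) → (labelAt t (k, i)).2 = (labelAt t (k, i + 1)).2 ∧
            (labelAt t (k + 1, i)).2 = (labelAt t (k + 1, i + 1)).2) := by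
        intro k i b hs
        obtain ⟨a, b, hab, h1, h2⟩ := h.exists_labelAt hs
        have e1 : ∀ k j, o.up (k, j) = (labelAt t (k, j)).1 := fun _ _ => rfl
        simp only [e1]
        cases hab with
        | parallel b o c d =>
          have a0 := h1 0 (by simp)
          have a1 := h1 1 (by simp)
          have b0 := h2 0 (by simp)
          have b1 := h2 1 (by simp)
          simp at a0 a1 b0 b1
          simp [a0, a1, b0, b1]
        | opposite b o c d =>
          have a0 := h1 0 (by simp)
          have a1 := h1 1 (by simp)
          have b0 := h2 0 (by simp)
          have b1 := h2 1 (by simp)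
          simp at a0 a1 b0 b1
          simp [a0, a1, b0, b1]
      cases hpq with
      | verticalLeft hs hu => exact ((key hs).1 hu).1
      | verticalRight hs hu => exact ((key hs).1 hu).2
      | lower hs hu => exact ((key hs).2 hu).1
      | upper hs hu => exact ((key hs).2 hu).2
  -- The label is a function of the Seifert circle, and every label that occurs is a value of it.
  let f := Quot.lift (fun p : D.Point => (labelAt t p.1).2) hr
  have hf : (colours t : Set ℕ) ⊆ Set.range f := by
    intro c hc
    obtain ⟨l, hl, hc⟩ := mem_colours.1 (Finset.mem_coe.1 hc)
    obtain ⟨z, hz, rfl⟩ := List.mem_map.1 hc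
    obtain ⟨p, rfl⟩ := D.exists_point_of_mem hP h hl hz
    exact ⟨Quot.mk _ p, rfl⟩
  calc (colours t).card = (colours t : Set ℕ).ncard := (Set.ncard_coe_finset _).symm
    _ ≤ (Set.range f).ncard := Set.ncard_le_ncard hf (Set.finite_range f)
    _ ≤ D.seifertCircles o := by
      rw [← Nat.card_coe_set_eq]
      exact Finite.card_range_le f

/-! Labelling a doubled diagram -/

/-- The parallel strands that replace the strands of a diagram run in opposite directions, and each
of them belongs to the Seifert circle given by the adjacent region of the diagram. -/
def strands : List ℕ → List (Bool × ℕ)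
  | a :: b :: G => (true, a) :: (false, b) :: strands (b :: G)
  | _ => []

theorem strands_append (G₁ : List ℕ) (g : ℕ) (G₂ : List ℕ) :
    strands (G₁ ++ g :: G₂) = strands (G₁ ++ [g]) ++ strands (g :: G₂) := by
  induction G₁ with
  | nil => simp [strands]
  | cons a G₁ ih =>
    cases G₁ with
    | nil => simp [strands]
    | cons b G₁ => simpa [strands] using ih

theorem length_strands (G : List ℕ) (g : ℕ) : (strands (g :: G)).length = 2 * G.length := by
  induction G generalizing g with
  | nil => rfl
  | cons a G ih => simp [strands, ih]; ring

theorem length_strands_append (G : List ℕ) (g : ℕ) :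
    (strands (G ++ [g])).length = 2 * G.length := by
  cases G with
  | nil => rfl
  | cons a G => simp [length_strands]

theorem strands_map (f : ℕ → ℕ) : ∀ G : List ℕ,
    strands (G.map f) = (strands G).map (Prod.map id f)
  | [] => rfl
  | [_] => rfl
  | a :: b :: G => by simpa [strands] using strands_map f (b :: G)

/-- Each region meets a strand as soon as there is a strand at all; a single region would leave no
trace in `strands`. -/
theorem subset_strands : ∀ G : List ℕ, 2 ≤ G.length →
    G.toFinset ⊆ ((strands G).map Prod.snd).toFinset
  | a :: b :: G, _ => by
    intro c hc
    by_cases hG : G = []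
    · subst hG; simpa [strands] using hc
    · have := subset_strands (b :: G) (by have := List.length_pos_iff.2 hG; simp; omega)
      simp only [strands, List.map_cons, List.toFinset_cons, Finset.mem_insert] at hc ⊢
      rcases hc with rfl | hc
      · simp
      · exact .inr (.inr (this (by simpa using hc)))

theorem Labels.map {w : List Slice} {x y : List (Bool × ℕ)} {t : List (List (Bool × ℕ))}
    (h : Labels SeifertLabels w x t y) (f : ℕ → ℕ) :
    Labels SeifertLabels w (x.map (Prod.map id f)) (t.map (List.map (Prod.map id f)))
      (y.map (Prod.map id f)) := by
  induction w generalizing x t with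
  | nil => obtain ⟨rfl, rfl⟩ := h; exact ⟨rfl, rfl⟩
  | cons s w ih =>
    obtain ⟨x', t', rfl, ⟨l, r, a, b, hl, hab, rfl, rfl⟩, h⟩ := h
    refine ⟨_, _, rfl, ⟨l.map (Prod.map id f), r.map (Prod.map id f), _, _, by simpa using hl,
      hab.map f, by simp, ?_⟩, ih h⟩
    simp

theorem colours_map (t : List (List (Bool × ℕ))) (f : ℕ → ℕ) :
    colours (t.map (List.map (Prod.map id f))) = (colours t).image f := by
  induction t with
  | nil => rfl
  | cons l t ih =>
    simp only [List.map_cons, colours_cons, ih, Finset.image_union]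
    congr 1
    ext c
    simp only [List.map_map, List.mem_toFinset, List.mem_map, Finset.mem_image, Function.comp_apply]
    constructor
    · rintro ⟨a, ha, rfl⟩; exact ⟨_, ⟨a, ha, rfl⟩, rfl⟩
    · rintro ⟨_, ⟨a, ha, rfl⟩, rfl⟩; exact ⟨a, ha, rfl⟩

/-- The word `w` with `2 * m` strands at the top has a labelling in which the strands at the top
are labelled according to the regions between `m` strands, and which has at least `m / 2 + 1 + e`
labels. -/
def Coloured (w : List Slice) (m e : ℕ) : Prop :=
  ∃ t G, Labels SeifertLabels w [] t (strands G) ∧ G.length = m + 1 ∧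
    m + 2 + 2 * e ≤ 2 * (colours t ∪ G.toFinset).card ∧
    (w = [] ∨ G.toFinset ⊆ colours (t ++ [strands G]))

theorem coloured_nil : Coloured [] 0 0 :=
  ⟨[], [0], ⟨rfl, rfl⟩, rfl, by simp, .inl rfl⟩

theorem exists_eq_append_of_lt {G : List ℕ} {i : ℕ} (h : i < G.length) :
    ∃ G₁ g G₂, G = G₁ ++ g :: G₂ ∧ G₁.length = i :=
  ⟨G.take i, G[i], G.drop (i + 1), by rw [← List.drop_eq_getElem_cons h, List.take_append_drop],
    by simp; omega⟩

theorem stepLabels_of_eq {q : Piece} {i : ℕ} {x y : List (Bool × ℕ)} (l r : List (Bool × ℕ))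
    {a b : List (Bool × ℕ)} (h : SeifertLabels q a b) (hl : l.length = i) (hx : x = l ++ a ++ r)
    (hy : y = l ++ b ++ r) : StepLabels SeifertLabels ⟨q, i⟩ x y :=
  ⟨l, r, a, b, hl, h, hx, hy⟩

/-- The set `A` collects labels that are known to be present. With `0 < m`, the labels of the top
regions are visible on the top strands. -/
theorem Coloured.extend {w v : List Slice} {m e : ℕ} {t t' : List (List (Bool × ℕ))}
    {G G' : List ℕ} (ht : Labels SeifertLabels w [] t (strands G))
    (ht' : Labels SeifertLabels v (strands G) t' (strands G')) (hG : G'.length = m + 1)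
    (hm : 0 < m) {A : Finset ℕ} (hA : m + 2 + 2 * e ≤ 2 * A.card)
    (hC : A ⊆ colours t ∪ colours t' ∪ G'.toFinset) : Coloured (w ++ v) m e := by
  refine ⟨t ++ t', G', labels_append.2 ⟨_, t, t', rfl, ht, ht'⟩, hG, ?_, .inr ?_⟩
  · rw [colours_append]
    have := Finset.card_le_card hC
    omega
  · refine (subset_strands G' (by omega)).trans ?_
    rw [colours_append, colours_cons]
    exact Finset.subset_union_left.trans Finset.subset_union_right

/-- A minimum opens a new region `n` inside the region `g`, so one new label pays for two more
strands. -/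
theorem Coloured.cup {w : List Slice} {m e i : ℕ} (h : Coloured w m e) (hi : i ≤ m) :
    Coloured (w ++ (cup i).double) (m + 2) e := by
  obtain ⟨t, G, ht, hG, hc, -⟩ := h
  obtain ⟨G₁, g, G₂, rfl, rfl⟩ := exists_eq_append_of_lt (G := G) (i := i) (by omega)
  obtain ⟨n, hn⟩ := Infinite.exists_notMem_finset (colours t ∪ (G₁ ++ g :: G₂).toFinset)
  have h1 : StepLabels SeifertLabels (KnotTheory.cup (2 * G₁.length)) (strands (G₁ ++ g :: G₂))
      (strands (G₁ ++ [g]) ++ [(true, g), (false, g)] ++ strands (g :: G₂)) :=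
    stepLabels_of_eq (strands (G₁ ++ [g])) (strands (g :: G₂)) (.cup true g)
      (length_strands_append _ _) (by rw [strands_append, List.append_nil]) rfl
  have h2 : StepLabels SeifertLabels (KnotTheory.cup (2 * G₁.length + 1))
      (strands (G₁ ++ [g]) ++ [(true, g), (false, g)] ++ strands (g :: G₂))
      (strands (G₁ ++ g :: n :: g :: G₂)) :=
    stepLabels_of_eq (strands (G₁ ++ [g]) ++ [(true, g)]) ((false, g) :: strands (g :: G₂))
      (.cup false n) (by simp [length_strands_append]) (by simp)
      (by simp [strands_append G₁ g (n :: g :: G₂), strands])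
  refine Coloured.extend ht ⟨_, _, rfl, h1, _, _, rfl, h2, rfl, rfl⟩
    (by simp at hG ⊢; omega) (by omega)
    (A := insert n (colours t ∪ (G₁ ++ g :: G₂).toFinset)) ?_ ?_
  · rw [Finset.card_insert_of_notMem hn]; omega
  · intro c
    simp only [Finset.mem_insert, Finset.mem_union, List.mem_toFinset, List.mem_append,
      List.mem_cons]
    tauto

/-- A maximum closes the region `a` and merges the regions `g` and `b` on its two sides. At most one
label is lost, for two strands fewer. -/
theorem Coloured.cap {w : List Slice} {m e i : ℕ} (h : Coloured w m e) (hi : i + 2 ≤ m) :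
    Coloured (w ++ (cap i).double) (m - 2) e := by
  obtain ⟨t, G, ht, hG, hc, -⟩ := h
  obtain ⟨G₁, g, G₂, rfl, rfl⟩ := exists_eq_append_of_lt (G := G) (i := i) (by omega)
  obtain ⟨a, b, G₂, rfl⟩ : ∃ a b G, G₂ = a :: b :: G := by
    rcases G₂ with _ | ⟨a, _ | ⟨b, G⟩⟩
    · simp at hG; omega
    · simp at hG; omega
    · exact ⟨a, b, G, rfl⟩
  -- The whole labelling below is renamed, since the merged regions may reach far down.
  let f : ℕ → ℕ := fun x => if x = b then g else x
  have hfb : f b = g := if_pos rfl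
  have hfg : f g = g := by simp [f]
  have ht' := ht.map f
  rw [← strands_map, List.map_append, List.map_cons, List.map_cons, List.map_cons, hfb, hfg] at ht'
  set G₁' := G₁.map f
  set G₂' := G₂.map f
  have hl : G₁'.length = G₁.length := List.length_map _
  have h1 : StepLabels SeifertLabels (KnotTheory.cap (2 * G₁.length + 1))
      (strands (G₁' ++ g :: f a :: g :: G₂'))
      (strands (G₁' ++ [g]) ++ [(true, g), (false, g)] ++ strands (g :: G₂')) :=
    stepLabels_of_eq (strands (G₁' ++ [g]) ++ [(true, g)]) ((false, g) :: strands (g :: G₂'))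
      (.cap false (f a)) (by simp [length_strands_append, hl])
      (by simp [strands_append G₁' g (f a :: g :: G₂'), strands]) (by simp)
  have h2 : StepLabels SeifertLabels (KnotTheory.cap (2 * G₁.length))
      (strands (G₁' ++ [g]) ++ [(true, g), (false, g)] ++ strands (g :: G₂'))
      (strands (G₁' ++ g :: G₂')) :=
    stepLabels_of_eq (strands (G₁' ++ [g])) (strands (g :: G₂')) (.cap true g)
      (by rw [length_strands_append, hl]) rfl (by rw [strands_append, List.append_nil])
  have hv : Labels SeifertLabels (KnotTheory.cap G₁.length).double _ _ _ :=
    ⟨_, _, rfl, h1, _, _, rfl, h2, rfl, rfl⟩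
  have hsub := subset_strands (G₁' ++ g :: f a :: g :: G₂') (by simp; omega)
  -- `Coloured.extend` does not apply, as no strand may be left at the top; the labels of the
  -- regions are found on the strands just below the maximum instead.
  refine ⟨_, G₁' ++ g :: G₂', labels_append.2 ⟨_, _, _, rfl, ht', hv⟩, ?_, ?_, .inr ?_⟩
  · simp [hl, G₂'] at hG ⊢; omega
  · have h3 : (colours t ∪ (G₁ ++ g :: a :: b :: G₂).toFinset).erase b ⊆
        (colours t ∪ (G₁ ++ g :: a :: b :: G₂).toFinset).image f := fun c hc =>
      Finset.mem_image.2 ⟨c, Finset.mem_of_mem_erase hc, if_neg (Finset.ne_of_mem_erase hc)⟩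
    have h4 := Finset.card_le_card h3
    have h5 := Finset.pred_card_le_card_erase (a := b)
      (s := colours t ∪ (G₁ ++ g :: a :: b :: G₂).toFinset)
    have h6 : (colours t ∪ (G₁ ++ g :: a :: b :: G₂).toFinset).image f ⊆
        colours (List.map (List.map (Prod.map id f)) t ++ [strands (G₁' ++ g :: f a :: g :: G₂'),
          strands (G₁' ++ [g]) ++ [(true, g), (false, g)] ++ strands (g :: G₂')]) ∪
          (G₁' ++ g :: G₂').toFinset := by
      rw [Finset.image_union, colours_append, colours_map, colours_cons]
      refine Finset.union_subset (fun c hc => ?_) (fun c hc => ?_)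
      · simp only [Finset.mem_union]; tauto
      · have : c ∈ (G₁' ++ g :: f a :: g :: G₂').toFinset := by
          obtain ⟨z, hz, rfl⟩ := Finset.mem_image.1 hc
          rw [List.mem_toFinset] at hz ⊢
          rw [show G₁' ++ g :: f a :: g :: G₂' = (G₁ ++ g :: a :: b :: G₂).map f by
            simp [hfb, hfg, G₁', G₂']]
          exact List.mem_map_of_mem hz
        have := hsub this
        simp only [Finset.mem_union]; tauto
    have h7 := Finset.card_le_card h6
    omega
  · intro c hc
    have : c ∈ (G₁' ++ g :: f a :: g :: G₂').toFinset := by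
      simp only [List.mem_toFinset, List.mem_append, List.mem_cons] at hc ⊢
      tauto
    have := hsub this
    simp only [colours_append, colours_cons, Finset.mem_union]; tauto

/-- The two antiparallel strands already carry one label `n`. Smoothing a crossing joins the lower
ends and the upper ends, so each of the `2 * k` crossings permits a fresh label above it. The set
`C` contains the labels already in use. -/
theorem exists_labels_twists (b : Bool) (l r : List (Bool × ℕ)) (k : ℕ) (C : Finset ℕ) (n : ℕ) :
    ∃ t n', Labels SeifertLabels (List.replicate (2 * k) (cross b l.length))
      (l ++ [(true, n), (false, n)] ++ r) t (l ++ [(true, n'), (false, n')] ++ r) ∧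
      (insert n C).card + 2 * k ≤ (C ∪ colours t ∪ {n'}).card := by
  induction k generalizing C n with
  | zero =>
    refine ⟨[], n, ⟨rfl, rfl⟩, ?_⟩
    simp only [colours_nil, Finset.union_empty, Finset.union_singleton, mul_zero, add_zero, le_refl]
  | succ k ih =>
    obtain ⟨n₁, h₁⟩ := Infinite.exists_notMem_finset (insert n C)
    obtain ⟨n₂, h₂⟩ := Infinite.exists_notMem_finset (insert n₁ (insert n C))
    obtain ⟨t, n', ht, hc⟩ := ih (insert n₁ (insert n C)) n₂
    refine ⟨_, n', ⟨_, _, rfl, stepLabels_of_eq l r (.opposite b true n n₁) rfl rfl rfl,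
      _, _, rfl, stepLabels_of_eq l r (.opposite b false n₁ n₂) rfl rfl rfl, ht⟩, ?_⟩
    rw [Finset.card_insert_of_notMem h₂, Finset.card_insert_of_notMem h₁] at hc
    refine le_trans (by omega) (hc.trans (Finset.card_le_card ?_))
    intro c
    simp only [Finset.mem_union, Finset.mem_insert, colours_cons, List.mem_toFinset, List.map_append,
      List.mem_append, List.map_cons, List.mem_cons]
    tauto

/-- Two pairs of parallel strands crossing each other, with full twists inside of the crossing. -/
def twistedCross (c b : Bool) (k p : ℕ) : List Slice :=
  [cross c (p + 1), cross c p] ++ List.replicate (2 * k) (cross b (p + 1)) ++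
    [cross c (p + 2), cross c (p + 1)]

/-- Of the four crossings, the lowest and the highest are antiparallel and the other two parallel.
Smoothing cuts off a circle in the middle (label `n`), which the twists subdivide, and separates the
upper region (label `n''`) from the lower one: `2 + 2 * k` new labels. -/
theorem Coloured.twistedCross {w : List Slice} {m e i : ℕ} (h : Coloured w m e) (hi : i + 2 ≤ m)
    (c b : Bool) (k : ℕ) :
    Coloured (w ++ twistedCross c b k (2 * i)) m (e + 2 + 2 * k) := by
  obtain ⟨t, G, ht, hG, hc, -⟩ := h
  obtain ⟨G₁, g, G₂, rfl, rfl⟩ := exists_eq_append_of_lt (G := G) (i := i) (by omega)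
  obtain ⟨g₁, g₂, G₂, rfl⟩ : ∃ a b G, G₂ = a :: b :: G := by
    rcases G₂ with _ | ⟨a, _ | ⟨b, G⟩⟩
    · simp at hG; omega
    · simp at hG; omega
    · exact ⟨a, b, G, rfl⟩
  set S₁ := strands (G₁ ++ [g])
  set S₂ := strands (g₂ :: G₂)
  have hl : S₁.length = 2 * G₁.length := length_strands_append _ _
  set C := colours t ∪ (G₁ ++ g :: g₁ :: g₂ :: G₂).toFinset
  obtain ⟨n, hn⟩ := Infinite.exists_notMem_finset C
  obtain ⟨t', n', ht', hc'⟩ := exists_labels_twists b (S₁ ++ [(true, g)]) ((false, g₂) :: S₂) k C n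
  obtain ⟨n'', hn''⟩ := Infinite.exists_notMem_finset (C ∪ colours t' ∪ {n'})
  have hx : strands (G₁ ++ g :: g₁ :: g₂ :: G₂) =
      (S₁ ++ [(true, g)]) ++ [(false, g₁), (true, g₁)] ++ ((false, g₂) :: S₂) := by
    rw [strands_append]
    simp [strands, S₁, S₂]
  have hy : strands (G₁ ++ g :: n'' :: g₂ :: G₂) =
      (S₁ ++ [(true, g)]) ++ [(false, n''), (true, n'')] ++ ((false, g₂) :: S₂) := by
    rw [strands_append]
    simp [strands, S₁, S₂]
  have hp : (S₁ ++ [(true, g)]).length = 2 * G₁.length + 1 := by simp [hl]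
  rw [hp] at ht'
  have h1 : Labels SeifertLabels [cross c (2 * G₁.length + 1), cross c (2 * G₁.length)]
      (strands (G₁ ++ g :: g₁ :: g₂ :: G₂)) _ _ :=
    ⟨_, _, rfl, stepLabels_of_eq _ _ (.opposite c false g₁ n) hp hx rfl, _, _, rfl,
      stepLabels_of_eq S₁ ((false, n) :: (false, g₂) :: S₂) (.parallel c true g n) hl (by simp)
        (y := (S₁ ++ [(true, g)]) ++ [(true, n), (false, n)] ++ ((false, g₂) :: S₂)) (by simp),
      rfl, rfl⟩
  have h2 : Labels SeifertLabels [cross c (2 * G₁.length + 2), cross c (2 * G₁.length + 1)]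
      ((S₁ ++ [(true, g)]) ++ [(true, n'), (false, n')] ++ ((false, g₂) :: S₂)) _
      (strands (G₁ ++ g :: n'' :: g₂ :: G₂)) :=
    ⟨_, _, rfl, stepLabels_of_eq (S₁ ++ [(true, g), (true, n')]) S₂ (.parallel c false n' g₂)
      (by simp [hl]) (by simp) rfl, _, _, rfl,
      stepLabels_of_eq _ _ (.opposite c true n' n'') hp (by simp) hy, rfl, rfl⟩
  refine Coloured.extend ht
    (labels_append.2 ⟨_, _, _, rfl, labels_append.2 ⟨_, _, _, rfl, h1, ht'⟩, h2⟩)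
    (by simp at hG ⊢; omega) (by omega) (A := insert n'' (C ∪ colours t' ∪ {n'})) ?_ ?_
  · rw [Finset.card_insert_of_notMem hn'']
    rw [Finset.card_insert_of_notMem hn] at hc'
    omega
  · have hs := subset_strands (G₁ ++ g :: g₁ :: g₂ :: G₂) (by simp; omega)
    rw [Finset.insert_subset_iff, Finset.union_subset_iff, Finset.union_subset_iff]
    refine ⟨?_, ⟨?_, ?_⟩, ?_⟩
    · simp
    · refine Finset.union_subset (fun c hc => ?_) (fun c hc => ?_)
      · simp only [Finset.mem_union]; tauto
      · have := hs hc
        simp only [colours_append, colours_cons, Finset.mem_union]; tauto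
    · intro c hc
      simp only [colours_append, Finset.mem_union]; tauto
    · simp

/-- Both crossings of the clasp are parallel, so smoothing leaves the adjacent regions alone and
cuts off one circle `n` in the middle. -/
theorem Coloured.clasp {w : List Slice} {m e i : ℕ} (h : Coloured w m e) (hi : i < m) (b : Bool) :
    Coloured (w ++ clasp b (2 * i)) m (e + 1) := by
  obtain ⟨t, G, ht, hG, hc, -⟩ := h
  obtain ⟨G₁, g, G₂, rfl, rfl⟩ := exists_eq_append_of_lt (G := G) (i := i) (by omega)
  obtain ⟨g₁, G₂, rfl⟩ : ∃ a G, G₂ = a :: G := by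
    rcases G₂ with _ | ⟨a, G⟩
    · simp at hG; omega
    · exact ⟨a, G, rfl⟩
  set S₁ := strands (G₁ ++ [g])
  set S₂ := strands (g₁ :: G₂)
  have hl : S₁.length = 2 * G₁.length := length_strands_append _ _
  set C := colours t ∪ (G₁ ++ g :: g₁ :: G₂).toFinset
  obtain ⟨n, hn⟩ := Infinite.exists_notMem_finset C
  have hx : strands (G₁ ++ g :: g₁ :: G₂) = (S₁ ++ [(true, g)]) ++ [] ++ ((false, g₁) :: S₂) := by
    rw [strands_append]
    simp [strands, S₁, S₂]
  have hp : (S₁ ++ [(true, g)]).length = 2 * G₁.length + 1 := by simp [hl]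
  have h1 : Labels SeifertLabels (KnotTheory.clasp b (2 * G₁.length))
      (strands (G₁ ++ g :: g₁ :: G₂)) _ (strands (G₁ ++ g :: g₁ :: G₂)) :=
    ⟨_, _, rfl, stepLabels_of_eq _ _ (.cup true n) hp hx rfl, _, _, rfl,
      stepLabels_of_eq S₁ ((false, n) :: (false, g₁) :: S₂) (.parallel b true g n) hl (by simp) rfl,
      _, _, rfl, stepLabels_of_eq (S₁ ++ [(true, g), (true, n)]) S₂ (.parallel b false n g₁)
        (by simp [hl]) (by simp) rfl, _, _, rfl,
      stepLabels_of_eq _ _ (.cap true n) hp (by simp) hx, rfl, rfl⟩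
  refine Coloured.extend ht h1 hG (by omega) (A := insert n C) ?_ ?_
  · rw [Finset.card_insert_of_notMem hn]; omega
  · rw [Finset.insert_subset_iff]
    refine ⟨by simp, Finset.union_subset (fun c hc => ?_) (fun c hc => ?_)⟩ <;>
      simp only [Finset.mem_union] <;> tauto

theorem Coloured.slice {w : List Slice} {m e : ℕ} (h : Coloured w m e) {s : Slice}
    (hs : s.pos + s.piece.ins ≤ m) :
    Coloured (w ++ s.double) (s.out m) (e + 2 * if s.isCrossing then 1 else 0) := by
  obtain ⟨q, i⟩ := s
  cases q with
  | cup => exact h.cup (i := i) hs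
  | cap => exact h.cap (i := i) hs
  | crossing b =>
    have e : Slice.out ⟨.crossing b, i⟩ m = m := by
      simp only [Slice.out, Piece.ins, Piece.outs] at hs ⊢; omega
    rw [e]
    -- An ordinary doubled crossing is the case without twists; the sign `true` is arbitrary.
    exact h.twistedCross hs b true 0

theorem Coloured.double {w v : List Slice} {m m' e : ℕ} (h : Coloured w m e) (hv : Fits m v m') :
    Coloured (w ++ double v) m' (e + 2 * v.countP Slice.isCrossing) := by
  induction v generalizing w m e with
  | nil =>
    obtain rfl : m = m' := hv
    simpa using h
  | cons s v ih =>
    have := ih (h.slice hv.1) hv.2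
    rw [List.append_assoc] at this
    rw [List.countP_cons, double_cons, Nat.mul_add, Nat.add_comm (2 * _), ← Nat.add_assoc]
    exact this

/-- At the top only the outer region remains. As the word is nonempty, its label occurs on a strand,
so it belongs to an actual Seifert circle. -/
theorem Coloured.exists_orientation {D : LinkDiagram} {e : ℕ} (h : Coloured D.word 0 e)
    (hD : D.word ≠ []) : ∃ o : D.Orientation, e + 1 ≤ D.seifertCircles o := by
  obtain ⟨t, G, ht, hG, hc, hs⟩ := h
  obtain ⟨g, rfl⟩ := List.length_eq_one_iff.1 hG
  obtain ⟨o, ho⟩ := LinkDiagram.exists_orientation ht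
  refine ⟨o, ?_⟩
  have h1 : colours t ∪ [g].toFinset = colours t := by
    refine Finset.union_eq_left.2 ((hs.resolve_left hD).trans ?_)
    simp [strands]
  rw [h1] at hc
  omega


/-! Whitehead doubles of isotopic diagrams -/

/-- Only the points provided by `LinkDiagram.Move.exists_eqv` are used: both diagrams of a move have
one. -/
theorem LinkDiagram.Isotopic.nonempty_iff {D E : LinkDiagram} (h : D.Isotopic E) :
    Nonempty D.Point ↔ Nonempty E.Point := by
  induction h with
  | rel D E h =>
    obtain ⟨e, he⟩ := h.exists_eqv
    obtain ⟨p, q, -⟩ := he true 0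
    exact iff_of_true ⟨p⟩ ⟨q⟩
  | refl D => rfl
  | symm D E _ ih => exact ih.symm
  | trans D E F _ _ ih ih' => exact ih.trans ih'

theorem LinkDiagram.Isotopic.components_eq_one_iff {D E : LinkDiagram} (h : D.Isotopic E) :
    D.components = 1 ↔ E.components = 1 := by
  rw [D.components_eq_one_iff, E.components_eq_one_iff, h.connected_iff, h.nonempty_iff]

/-- Isotopic knot diagrams have isotopic Whitehead doubles, after a change of the number of
twists. -/
theorem LinkDiagram.Isotopic.exists_eqv {D E : LinkDiagram} (h : D.Isotopic E)
    (hD : D.components = 1) :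
    ∃ e : ℤ, ∀ c n (p : D.Point) (q : E.Point),
      Eqv 0 (insertAt D.word (bead c n) p.1) (insertAt E.word (bead c (n + e)) q.1) := by
  have hE := (LinkDiagram.Isotopic.components_eq_one_iff h).1 hD
  induction h with
  | rel D E h =>
    obtain ⟨e, he⟩ := h.exists_eqv
    refine ⟨e, fun c n p q => ?_⟩
    obtain ⟨p', q', h'⟩ := he c n
    exact ((slides_bead c n).insertAt_eqv_of_connected (D.components_eq_one_iff.1 hD).1 p p').trans
      (h'.trans ((slides_bead c _).insertAt_eqv_of_connected (E.components_eq_one_iff.1 hE).1 q' q))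
  | refl D =>
    refine ⟨0, fun c n p q => ?_⟩
    rw [add_zero]
    exact (slides_bead c n).insertAt_eqv_of_connected (D.components_eq_one_iff.1 hD).1 p q
  | symm D E _ ih =>
    obtain ⟨e, he⟩ := ih hE hD
    refine ⟨-e, fun c n p q => ?_⟩
    have := he c (n + -e) q p
    rw [neg_add_cancel_right] at this
    exact this.symm
  | trans D E F h _ ih ih' =>
    -- The intermediate diagram is merely a link diagram a priori; beads can be moved freely on it
    -- only because it is again a knot diagram.
    have hE' := (LinkDiagram.Isotopic.components_eq_one_iff h).1 hD
    obtain ⟨e, he⟩ := ih hD hE'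
    obtain ⟨e', he'⟩ := ih' hE' hE
    obtain ⟨p'⟩ := (E.components_eq_one_iff.1 hE').2
    refine ⟨e + e', fun c n p q => ?_⟩
    rw [← add_assoc]
    exact (he c n p p').trans (he' c (n + e) p' q)

/-! The twists of a Whitehead double inside of a doubled crossing -/

/-- The twists slide along their band past the first strand of the other band and stop there; the
clasp stays in front of the crossing. -/
theorem eqv_twistedCross {m i : ℕ} (hi : i + 2 ≤ m) (b c : Bool) (n : ℤ) :
    Eqv (2 * m) (shift (2 * i) (bead b n) ++ (cross c i).double)
      (clasp b (2 * i) ++ twistedCross c (decide (0 < n)) n.natAbs (2 * i)) := by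
  obtain ⟨r, rfl⟩ := Nat.exists_eq_add_of_le hi
  have h1 := ((slides_replicate (decide (0 < n)) (2 * n.natAbs)).left c).append [cross c 2, cross c 1]
  have h2 := (h1.widen 1).prepend (n := 4) ((fits_clasp b).widen 2)
  have h3 := h2.shift (2 * i) (2 * r)
  rw [Nat.mul_add, Nat.mul_add]
  have e1 : shift (2 * i) (bead b n) ++ (cross c i).double =
      shift (2 * i) (clasp b 0 ++ (List.replicate (2 * n.natAbs) (cross (decide (0 < n)) 0) ++
        [cross c 1, cross c 0] ++ [cross c 2, cross c 1])) := by
    simp [bead, twists, Slice.double]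
  have e2 : clasp b (2 * i) ++ twistedCross c (decide (0 < n)) n.natAbs (2 * i) =
      shift (2 * i) (clasp b 0 ++ ([cross c 1, cross c 0] ++
        shift 1 (List.replicate (2 * n.natAbs) (cross (decide (0 < n)) 0)) ++
          [cross c 2, cross c 1])) := by
    rw [shift_append, shift_clasp]
    simp [twistedCross, shift]
  rw [e1, e2]
  exact h3

theorem countP_double (w : List Slice) :
    (double w).countP Slice.isCrossing = 4 * w.countP Slice.isCrossing := by
  induction w with
  | nil => rfl
  | cons s w ih =>
    obtain ⟨q, i⟩ := s
    rw [double_cons, List.countP_append, ih, List.countP_cons, Nat.mul_add, Nat.add_comm]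
    congr 1
    cases q <;> rfl

theorem countP_twistedCross (c b : Bool) (k p : ℕ) :
    (twistedCross c b k p).countP Slice.isCrossing = 4 + 2 * k := by
  have h : (List.replicate (2 * k) (cross b (p + 1))).countP Slice.isCrossing = 2 * k := by
    simp [List.countP_replicate, Slice.isCrossing]
  simp only [twistedCross, List.countP_append, h]
  change 2 + 2 * k + 2 = 4 + 2 * k
  omega

theorem exists_eq_append_cross {w : List Slice} (h : 0 < w.countP Slice.isCrossing) :
    ∃ u c i v, w = u ++ cross c i :: v := by
  obtain ⟨⟨q, i⟩, hs, hc⟩ := List.countP_pos_iff.1 h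
  obtain ⟨u, v, rfl⟩ := List.append_of_mem hs
  cases q with
  | crossing c => exact ⟨u, c, i, v, rfl⟩
  | cup => cases hc
  | cap => cases hc

/-- If the full twists of a Whitehead double lie inside of one of the doubled crossings, then its
genus is at most the number of crossings of the original diagram. -/
theorem exists_genus_le {D E : LinkDiagram} {u v : List Slice} {b c s : Bool} {i k : ℕ}
    (hD : D.word = u ++ cross c i :: v)
    (hE : E.word = double u ++ (clasp b (2 * i) ++ twistedCross c s k (2 * i)) ++ double v)
    (hE1 : E.components = 1) : ∃ o : E.Orientation, E.genus o ≤ D.crossings := by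
  have hf := D.closed
  rw [hD, fits_append] at hf
  obtain ⟨m, hu, hi, hv⟩ := hf
  have hm : (cross c i).out m = m := by
    simp only [Slice.out, Piece.ins, Piece.outs] at hi ⊢; omega
  rw [hm] at hv
  have hi : i + 2 ≤ m := hi
  have h := (((coloured_nil.double hu).clasp (i := i) (by omega) b).twistedCross hi c s k).double hv
  have hw : [] ++ double u ++ clasp b (2 * i) ++ twistedCross c s k (2 * i) ++ double v = E.word := by
    rw [hE]; simp
  rw [hw] at h
  obtain ⟨o, ho⟩ := h.exists_orientation (by rw [hE]; simp [clasp])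
  refine ⟨o, ?_⟩
  have h1 : D.crossings = u.countP Slice.isCrossing + (v.countP Slice.isCrossing + 1) := by
    rw [LinkDiagram.crossings, hD, List.countP_append, List.countP_cons]; rfl
  have h2 : E.crossings = 4 * u.countP Slice.isCrossing + (2 + (4 + 2 * k)) +
      4 * v.countP Slice.isCrossing := by
    rw [LinkDiagram.crossings, hE, List.countP_append, List.countP_append, List.countP_append,
      countP_double, countP_double, countP_twistedCross]
    rfl
  rw [LinkDiagram.genus, hE1, h1, h2]
  -- With `c` crossings in `D`, there are `4c + 2 + 2k` crossings in `E` and at least `2c + 2 + 2k`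
  -- Seifert circles, so the genus is at most `(2c + 1) / 2`, rounded down to `c`.
  omega

theorem insertAt_whitehead (u v : List Slice) (j : ℕ) (b : Bool) (n : ℤ) :
    insertAt (u ++ v) (bead b n) (u.length, j) =
      double u ++ clasp b (2 * j) ++ twists n (2 * j) ++ double v := by
  rw [insertAt_append, insertDouble, shift_bead]
  simp only [List.append_assoc]

end KnotTheory

/-! ### The inequality between crossing number and canonical genus -/

open KnotTheory in
theorem mainTheorem11 (K W : KnotTheory.Knot) (hK : ¬ K.IsTrivial)
    (hW : KnotTheory.IsWhiteheadDouble W K) :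
    W.canonicalGenus ≤ K.crossingNumber := by
  obtain ⟨D, E, hD, hE, u, v, j, b, n, huv, hj, hw⟩ := hW
  obtain ⟨D₀, hD₀, hc⟩ := Nat.sInf_mem
    (s := {n : ℕ | ∃ D : KnotDiagram, D.Represents K ∧ n = D.1.crossings}) ⟨_, D, hD, rfl⟩
  -- Nontriviality provides the crossing in which the twists are hidden.
  have hpos : 0 < D₀.1.crossings := Nat.pos_of_ne_zero fun h => hK ⟨D₀, hD₀, h⟩
  obtain ⟨u₀, c, i, v₀, hw₀⟩ := exists_eq_append_cross hpos
  have hiso : D.1.Isotopic D₀.1 := Quotient.exact (hD.trans hD₀.symm)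
  obtain ⟨e, he⟩ := hiso.exists_eqv D.2
  have hf := D₀.1.closed
  rw [hw₀, fits_append] at hf
  obtain ⟨m, hu₀, hv₀⟩ := hf
  have hi : i + 2 ≤ m := hv₀.1
  -- The bead is moved to the lower left strand of the chosen crossing, the band whose twists
  -- `eqv_twistedCross` can push inside.
  have h1 := he b n ⟨(u.length, j), hj⟩
    ⟨(u₀.length, i), by rw [hw₀, width_append hu₀]; simp only; omega⟩
  simp only [huv, hw₀] at h1
  rw [insertAt_whitehead, ← hw, insertAt_append, insertDouble, double_cons,
    ← List.append_assoc, List.append_assoc (double u₀)] at h1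
  have h2 := h1.trans ((eqv_twistedCross hi b c (n + e)).ctx hu₀.double (double v₀))
  let F : LinkDiagram := ⟨_, h2.fits_iff.1 E.1.closed⟩
  have hEF : E.1.Isotopic F := h2.isotopic _ _ rfl rfl
  have hF := hEF.components_eq_one_iff.1 E.2
  obtain ⟨o, ho⟩ := exists_genus_le (E := F) hw₀ rfl hF
  have hW : KnotDiagram.Represents ⟨F, hF⟩ W :=
    (Quotient.sound (s := KnotDiagram.setoid) hEF.symm).trans hE
  have hg : W.canonicalGenus ≤ F.genus o := Nat.sInf_le ⟨⟨F, hF⟩, hW, o, rfl⟩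
  exact hg.trans (ho.trans hc.ge)
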